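/- Let $d\ge 2$, let $A=\{1,\dots,d\}$, let $A^\omega$ be the space of infinite words over $A$ with the product topology, and let $H$ be a subgroup of the symmetric group $\Sigma_d$ on $A$. For a finite word $v$ write $vA^\omega$ for the set of infinite words beginning with $v$. Let $V_d(H)$ be the group of all homeomorphisms $g$ of $A^\omega$ such that every $x\in A^\omega$ lies in some $vA^\omega$ for which there are a finite word $u$ and $h\in H$ with $$g(vx_1x_2x_3\dots)=u\,h(x_1)h(x_2)h(x_3)\dots\qquad\text{for all } x_1x_2x_3\dots\in A^\omega .$$ An ordered table for $g\in V_d(H)$ consists of finite words $v_1\le\dots\le v_m$ and $u_1\le\dots\le u_m$ (lexicographic order) such that $\{v_iA^\omega\}_{i=1}^m$ and $\{u_iA^\omega\}_{i=1}^m$ are partitions of $A^\omega$ into $m$ sets, elements $h_1,\dots,h_m\in H$ and a permutation $\sigma\in\Sigma_m$ such that $g(v_ix_1x_2\dots)=u_{\sigma(i)}h_i(x_1)h_i(x_2)\dots$ for all $i$ and all $x_1x_2\dots\in A^\omega$. The element $g$ is called even if it has an ordered table with $\sigma$ an even permutation. Let $V'_d(H)=V_d(H)$ if $d$ is even or $H$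 contains an odd permutation; otherwise let $V'_d(H)$ be the set of even elements of $V_d(H)$. Then $V'_d(H)$ is a subgroup of $V_d(H)$, and its commutator subgroup $[V'_d(H),V'_d(H)]$ is a simple group and has finite index in $V_d(H)$. In particular, $V_d(H)$ has a simple subgroup of finite index. -/

import Mathlib

namespace NekrashevychRover

/-- The infinite word `v x`: the finite word `v` followed by the infinite word `x`. -/
def prepend {α : Type*} : List α → (ℕ → α) → ℕ → α
  | [], x, n => x n
  | a :: _, _, 0 => a
  | _ :: v, x, n + 1 => prepend v x n

/-- The ball (cylinder) `v A^ω` of all infinite words that start with `v`. -/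
def cylinder {α : Type*} (v : List α) : Set (ℕ → α) := Set.range (prepend v)

theorem prepend_nil {α : Type*} (x : ℕ → α) : prepend [] x = x := by
  funext n; simp [prepend]

theorem prepend_append {α : Type*} (v w : List α) (x : ℕ → α) :
    prepend (v ++ w) x = prepend v (prepend w x) := by
  induction v with
  | nil => simp [prepend_nil]
  | cons a v ih =>
    funext n
    cases n with
    | zero => rfl
    | succ n => exact congrFun ih n

theorem prepend_map {α : Type*} (s : α → α) (v : List α) (x : ℕ → α) :
    s ∘ prepend v x = prepend (v.map s) (s ∘ x) := by
  induction v with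
  | nil => simp [prepend_nil]
  | cons a v ih =>
    funext n
    cases n with
    | zero => rfl
    | succ n => exact congrFun ih n

/-- If two cylinders meet, then one of the two words is a prefix of the other. -/
theorem prepend_eq_prepend {α : Type*} (v w : List α) (x y : ℕ → α)
    (h : prepend v x = prepend w y) :
    (∃ p, w = v ++ p ∧ x = prepend p y) ∨ (∃ p, v = w ++ p ∧ y = prepend p x) := by
  induction v generalizing w with
  | nil => exact Or.inl ⟨w, rfl, by rwa [prepend_nil] at h⟩
  | cons a v ih =>
    cases w with
    | nil => exact Or.inr ⟨a :: v, rfl, by rw [prepend_nil] at h; exact h.symm⟩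
    | cons b w =>
      have h0 : a = b := congrFun h 0
      have h1 : prepend v x = prepend w y := funext fun n => congrFun h (n + 1)
      subst h0
      rcases ih w h1 with ⟨p, hp, hx⟩ | ⟨p, hp, hx⟩
      · exact Or.inl ⟨p, by rw [hp]; rfl, hx⟩
      · exact Or.inr ⟨p, by rw [hp]; rfl, hx⟩

/-- `g` restricts to an element of `Sim(v A^ω, u A^ω)`, given by the letter permutation `s`:
`g (v x₁ x₂ …) = u s(x₁) s(x₂) …` for every infinite word `x₁ x₂ …`. -/
def ActsAs {d : ℕ} (g : (ℕ → Fin d) ≃ₜ (ℕ → Fin d)) (v u : List (Fin d))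
    (s : Equiv.Perm (Fin d)) : Prop :=
  ∀ x : ℕ → Fin d, g (prepend v x) = prepend u (s ∘ x)

/-- The group `V_d(H)`: all homeomorphisms of `A^ω = ℕ → Fin d` that are locally determined by
the finite similarity structure of `H`, that is, every point lies in a ball `v A^ω` on which the
homeomorphism is a similarity `v x ↦ u s(x)` onto a ball `u A^ω`, with `s ∈ H`. -/
def V (d : ℕ) (H : Subgroup (Equiv.Perm (Fin d))) :
    Subgroup ((ℕ → Fin d) ≃ₜ (ℕ → Fin d)) where
  carrier := {g | ∀ x, ∃ v u : List (Fin d), ∃ s ∈ H, x ∈ cylinder v ∧ ActsAs g v u s}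
  one_mem' := fun x => ⟨[], [], 1, H.one_mem, ⟨x, prepend_nil x⟩, fun y => by
    simp [prepend_nil]⟩
  mul_mem' := by
    intro g f hg hf x
    obtain ⟨v, u, s, hs, ⟨y, rfl⟩, hact⟩ := hf x
    obtain ⟨v', u', s', hs', ⟨z, hz⟩, hact'⟩ := hg (f (prepend v y))
    rw [hact y] at hz
    rcases prepend_eq_prepend _ _ _ _ hz with ⟨p, rfl, -⟩ | ⟨p, rfl, hy⟩
    · refine ⟨v, u' ++ p.map s', s' * s, H.mul_mem hs' hs, ⟨y, rfl⟩, fun x => ?_⟩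
      rw [Homeomorph.mul_apply, hact, prepend_append, hact', prepend_map, prepend_append]
      rfl
    · have hc : ∀ q : ℕ → Fin d, s ∘ ((s⁻¹ : Equiv.Perm (Fin d)) ∘ q) = q := fun q => by
        funext n; simp
      refine ⟨v ++ p.map (s⁻¹ : Equiv.Perm (Fin d)), u', s' * s, H.mul_mem hs' hs,
        ⟨(s⁻¹ : Equiv.Perm (Fin d)) ∘ z, ?_⟩, fun x => ?_⟩
      · rw [prepend_append, ← prepend_map, ← hy]
        congr 1
        funext n; simp
      · have hx : x = (s⁻¹ : Equiv.Perm (Fin d)) ∘ (s ∘ x) := by funext n; simp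
        rw [Homeomorph.mul_apply, prepend_append, hact]
        conv_lhs => rw [hx]
        rw [← prepend_map, hc, ← prepend_append, hact']
        rfl
  inv_mem' := by
    intro g hg x
    obtain ⟨v, u, s, hs, ⟨y, hy⟩, hact⟩ := hg (g⁻¹ x)
    refine ⟨u, v, s⁻¹, H.inv_mem hs, ⟨s ∘ y, ?_⟩, fun z => ?_⟩
    · rw [← hact, hy]
      exact g.apply_symm_apply x
    · have hz : g (prepend v ((s⁻¹ : Equiv.Perm (Fin d)) ∘ z)) = prepend u z := by
        rw [hact]
        congr 1
        funext n; simp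
      rw [← hz]
      exact g.symm_apply_apply _

/-- The balls `w 0 A^ω, …, w (m - 1) A^ω` form a partition of `A^ω`. -/
def IsPartition {d m : ℕ} (w : Fin m → List (Fin d)) : Prop :=
  ∀ x : ℕ → Fin d, ∃! i, x ∈ cylinder (w i)

/-- `(v, h, u, σ)` is an ordered table for `g`: the `v i` and the `u i` are listed in
lexicographic order, their balls partition `A^ω`, and
`g (v_i x₁ x₂ …) = u_{σ(i)} h_i(x₁) h_i(x₂) …` for every `i`, with `h_i ∈ H`. -/
structure IsTable {d : ℕ} (H : Subgroup (Equiv.Perm (Fin d)))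
    (g : (ℕ → Fin d) ≃ₜ (ℕ → Fin d)) {m : ℕ} (v : Fin m → List (Fin d))
    (h : Fin m → Equiv.Perm (Fin d)) (u : Fin m → List (Fin d))
    (σ : Equiv.Perm (Fin m)) : Prop where
  mem : ∀ i, h i ∈ H
  domain : IsPartition v
  range : IsPartition u
  domain_ordered : Monotone v
  range_ordered : Monotone u
  acts : ∀ i, ActsAs g (v i) (u (σ i)) (h i)

/-- `g` is even: it has an ordered table whose permutation `σ` is even. -/
def IsEvenElement {d : ℕ} (H : Subgroup (Equiv.Perm (Fin d)))
    (g : (ℕ → Fin d) ≃ₜ (ℕ → Fin d)) : Prop :=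
  ∃ (m : ℕ) (v : Fin m → List (Fin d)) (h : Fin m → Equiv.Perm (Fin d))
    (u : Fin m → List (Fin d)) (σ : Equiv.Perm (Fin m)),
    IsTable H g v h u σ ∧ Equiv.Perm.sign σ = 1

/-- The set `V'_d(H)`: all of `V_d(H)` if `d` is even or `H` contains an odd permutation, and
the set of even elements of `V_d(H)` otherwise. -/
def VPrime (d : ℕ) (H : Subgroup (Equiv.Perm (Fin d))) : Set (V d H) :=
  {g | Even d ∨ (∃ s ∈ H, Equiv.Perm.sign s = -1) ∨
    IsEvenElement H (g : (ℕ → Fin d) ≃ₜ (ℕ → Fin d))}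

end NekrashevychRover

/-!
Write `E` (`altV H`) for the subgroup of `V d H` generated by the copies of `A₅` that permute five
disjoint framed cylinders not covering the space. Here a framed cylinder `(w, s)` is the cylinder
of `w` together with the parametrization `x ↦ w s(x)`, so that the elements of `V d H` are the
homeomorphisms that locally carry frames to frames. The theorem follows from three facts.

*`E` is simple and is the commutator subgroup of every group between `E` and `V d H`.* Moving
frames one at a time by double transpositions shows that `E` is transitive on the finite families
of disjoint frames of a given size that do not cover the space (`exists_altV_maps`). Hence every
element of `V d H` agrees with an element of `E` outside any given cylinder
(`exists_altV_eq_off`). It follows that `E` is normal, and that modulo `E` any two elements can be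
moved into disjoint cylinders, where they commute: `V d H` is abelian modulo `E`
(`commutator_mem_altV`). A nontrivial subgroup normalized by `E` contains, by a double commutator
argument and the simplicity of `A₅`, one of the generating copies of `A₅`, hence all of them by
transitivity (`altV_le_of_conj_mem`). So `E` is simple and perfect.

*`E` has finite index.* The quotient is abelian, so it suffices to generate `V d H`, modulo `E`, by
finitely many elements of finite order. Merging the pieces of a partition step by step shows that
permutations of frames and rotations `v x ↦ v s(x)` generate `V d H` (`mem_of_generators`), and by
the transitivity of `E` these are conjugate to one exchange of two frames and to the rotations of
one cylinder.

*`V'` is a subgroup that contains `E`.* This is clear when `V'` is all of `V d H`. Otherwise `d` is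
odd and `H` consists of even permutations. The sign of the permutation of an ordered table is
determined by the parity of the number of inversions of the element on the pieces of the table.
Splitting a piece into its `d` children preserves this parity (`inversionSign_expand`), so it does
not depend on the table, and the sign is multiplicative because tables with a common middle
partition compose. Thus `V'` is the kernel of a homomorphism to `{±1}` (`signHom`), and it contains
the perfect group `E`.
-/

namespace NekrashevychRover

open Set Function
open scoped commutatorElement

/-! ### Cylinders -/

section Words

variable {d : ℕ}

theorem prepend_apply_of_lt {α : Type*} (v : List α) (x : ℕ → α) (n : ℕ) (h : n < v.length) :
    prepend v x n = v[n] := by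
  induction v generalizing n with
  | nil => simp at h
  | cons a v ih =>
    cases n with
    | zero => rfl
    | succ n => exact ih n (by simpa using h)

theorem prepend_apply_add {α : Type*} (v : List α) (x : ℕ → α) (n : ℕ) :
    prepend v x (v.length + n) = x n := by
  induction v with
  | nil => simp [prepend_nil]
  | cons a v ih =>
    rw [List.length_cons, Nat.add_right_comm]
    exact ih

theorem prepend_injective {α : Type*} (v : List α) : Injective (prepend v) := fun x y h =>
  funext fun n => by rw [← prepend_apply_add v x, h, prepend_apply_add]

theorem prepend_mem_cylinder {α : Type*} (v : List α) (x : ℕ → α) : prepend v x ∈ cylinder v :=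
  ⟨x, rfl⟩

theorem cylinder_nil {α : Type*} : cylinder ([] : List α) = univ :=
  eq_univ_of_forall fun x => ⟨x, prepend_nil x⟩

theorem mem_cylinder_iff {α : Type*} {v : List α} {x : ℕ → α} :
    x ∈ cylinder v ↔ ∀ (n : ℕ) (h : n < v.length), x n = v[n] := by
  constructor
  · rintro ⟨y, rfl⟩ n h
    exact prepend_apply_of_lt v y n h
  · intro h
    refine ⟨fun n => x (v.length + n), funext fun n => ?_⟩
    rcases lt_or_ge n v.length with hn | hn
    · rw [prepend_apply_of_lt v _ n hn, h n hn]
    · obtain ⟨k, rfl⟩ := Nat.exists_eq_add_of_le hn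
      rw [prepend_apply_add]

theorem cylinder_append_subset {α : Type*} (v p : List α) : cylinder (v ++ p) ⊆ cylinder v := by
  rintro _ ⟨x, rfl⟩
  rw [prepend_append]
  exact prepend_mem_cylinder _ _

theorem disjoint_cylinder_append {α : Type*} (v : List α) {p q : List α}
    (h : Disjoint (cylinder p) (cylinder q)) :
    Disjoint (cylinder (v ++ p)) (cylinder (v ++ q)) := by
  rw [Set.disjoint_left] at h ⊢
  rintro _ ⟨x, rfl⟩ ⟨y, hy⟩
  rw [prepend_append, prepend_append] at hy
  have := prepend_injective v hy
  exact h ⟨x, rfl⟩ ⟨y, this⟩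

theorem cylinder_ofFn (x : ℕ → Fin d) (n : ℕ) :
    cylinder (List.ofFn fun i : Fin n => x i) = PiNat.cylinder x n := by
  ext y
  rw [mem_cylinder_iff, PiNat.mem_cylinder_iff]
  simp

theorem isOpen_cylinder (v : List (Fin d)) : IsOpen (cylinder v) := by
  rw [isOpen_iff_mem_nhds]
  intro x hx
  refine Filter.mem_of_superset
    ((PiNat.isOpen_cylinder (fun _ : ℕ => Fin d) x v.length).mem_nhds
      (PiNat.self_mem_cylinder x _)) fun y hy => ?_
  rw [PiNat.mem_cylinder_iff] at hy
  rw [mem_cylinder_iff] at hx ⊢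
  intro n hn
  rw [hy n hn, hx n hn]

theorem continuous_prepend (v : List (Fin d)) : Continuous (prepend v) := by
  refine continuous_pi fun n => ?_
  rcases lt_or_ge n v.length with hn | hn
  · simp only [prepend_apply_of_lt v _ n hn]
    exact continuous_const
  · obtain ⟨k, rfl⟩ := Nat.exists_eq_add_of_le hn
    simp only [prepend_apply_add]
    exact continuous_apply k

theorem isClosed_cylinder (v : List (Fin d)) : IsClosed (cylinder v) := by
  unfold cylinder
  exact (isCompact_range (continuous_prepend v)).isClosed

theorem exists_cylinder_subset {U : Set (ℕ → Fin d)} (hU : IsOpen U) {x : ℕ → Fin d}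
    (hx : x ∈ U) : ∃ v, x ∈ cylinder v ∧ cylinder v ⊆ U := by
  obtain ⟨_, ⟨y, n, rfl⟩, hy, hs⟩ :=
    (PiNat.isTopologicalBasis_cylinders (fun _ : ℕ => Fin d)).exists_subset_of_mem_open hx hU
  rw [← cylinder_ofFn] at hy hs
  exact ⟨_, hy, hs⟩

/-- There are infinitely many pairwise disjoint cylinders, namely those of `bⁱa` with `a ≠ b`. -/
theorem exists_pairwise_disjoint_cylinders [Nontrivial (Fin d)] :
    ∃ p : ℕ → List (Fin d), Pairwise (Disjoint on fun i => cylinder (p i)) := by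
  obtain ⟨a, b, hab⟩ := exists_pair_ne (Fin d)
  refine ⟨fun i => List.replicate i b ++ [a], ?_⟩
  have key : ∀ i j, i < j →
      Disjoint (cylinder (List.replicate i b ++ [a])) (cylinder (List.replicate j b ++ [a])) := by
    intro i j hij
    rw [Set.disjoint_left]
    intro x hx hy
    rw [mem_cylinder_iff] at hx hy
    have h1 := hx i (by simp)
    have h2 := hy i (by simp; omega)
    rw [h1] at h2
    simp [hij] at h2
    exact hab h2
  intro i j hij
  rcases lt_or_gt_of_ne hij with h | h
  · exact key i j h
  · exact (key j i h).symm

/-- The space of infinite words has no isolated points. -/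
theorem exists_ne_mem_of_isOpen [Nontrivial (Fin d)] {U : Set (ℕ → Fin d)} (hU : IsOpen U)
    (hne : U.Nonempty) (x : ℕ → Fin d) : ∃ y ∈ U, y ≠ x := by
  obtain ⟨z, hz⟩ := hne
  obtain ⟨v, -, hv⟩ := exists_cylinder_subset hU hz
  obtain ⟨a, b, hab⟩ := exists_pair_ne (Fin d)
  by_cases h : prepend v (fun _ => a) = x
  · refine ⟨prepend v (fun _ => b), hv (prepend_mem_cylinder _ _), fun h' => hab ?_⟩
    exact congrFun (prepend_injective v (h.trans h'.symm)) 0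
  · exact ⟨_, hv (prepend_mem_cylinder _ _), h⟩

/-- Two nonempty open sets contain disjoint cylinders. -/
theorem exists_disjoint_cylinders [Nontrivial (Fin d)] {U U' : Set (ℕ → Fin d)} (hU : IsOpen U)
    (hne : U.Nonempty) (hU' : IsOpen U') (hne' : U'.Nonempty) :
    ∃ v v', cylinder v ⊆ U ∧ cylinder v' ⊆ U' ∧ Disjoint (cylinder v) (cylinder v') := by
  obtain ⟨x, hx⟩ := hne
  obtain ⟨y, hy, hyx⟩ := exists_ne_mem_of_isOpen hU' hne' x
  obtain ⟨A, B, hA, hB, hxA, hyB, hAB⟩ := t2_separation hyx.symm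
  obtain ⟨v, -, hv⟩ := exists_cylinder_subset (hU.inter hA) ⟨hx, hxA⟩
  obtain ⟨v', -, hv'⟩ := exists_cylinder_subset (hU'.inter hB) ⟨hy, hyB⟩
  exact ⟨v, v', fun z hz => (hv hz).1, fun z hz => (hv' hz).1,
    hAB.mono (fun z hz => (hv hz).2) (fun z hz => (hv' hz).2)⟩

end Words

/-! ### Framed cylinders -/

section Frames

variable {d : ℕ}

/-- A framed cylinder: a finite word `w` and a letter permutation `s`. It stands for the
parametrization `x ↦ w s(x)` of the cylinder of `w`. -/
abbrev Frame (d : ℕ) := List (Fin d) × Equiv.Perm (Fin d)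

/-- The parametrization `x ↦ w s(x)` given by the framed cylinder `(w, s)`. -/
def emb (F : Frame d) (x : ℕ → Fin d) : ℕ → Fin d := prepend F.1 (F.2 ∘ x)

/-- `g` carries the parametrization of `F` to that of `G`. -/
def Maps (g : (ℕ → Fin d) ≃ₜ (ℕ → Fin d)) (F G : Frame d) : Prop := ∀ x, g (emb F x) = emb G x

theorem perm_comp_inv_comp (s : Equiv.Perm (Fin d)) (x : ℕ → Fin d) : s ∘ (⇑s⁻¹ ∘ x) = x := by
  funext n; simp

theorem perm_inv_comp_comp (s : Equiv.Perm (Fin d)) (x : ℕ → Fin d) : ⇑s⁻¹ ∘ (s ∘ x) = x := by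
  funext n; simp

theorem emb_one (v : List (Fin d)) (x : ℕ → Fin d) : emb (v, 1) x = prepend v x := rfl

theorem emb_mem (F : Frame d) (x : ℕ → Fin d) : emb F x ∈ cylinder F.1 :=
  prepend_mem_cylinder _ _

theorem mem_cylinder_iff_emb {F : Frame d} {x : ℕ → Fin d} :
    x ∈ cylinder F.1 ↔ ∃ y, emb F y = x := by
  constructor
  · rintro ⟨y, rfl⟩
    exact ⟨⇑F.2⁻¹ ∘ y, by rw [emb, perm_comp_inv_comp]⟩
  · rintro ⟨y, rfl⟩
    exact emb_mem F y

theorem emb_injective (F : Frame d) : Injective (emb F) := fun x y h => by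
  have := prepend_injective _ h
  rw [← perm_inv_comp_comp F.2 x, this, perm_inv_comp_comp]

/-- The subcylinder of `F` with parametrization `x ↦ emb F (p x)`. -/
def Frame.child (F : Frame d) (p : List (Fin d)) : Frame d := (F.1 ++ p.map F.2, F.2)

theorem emb_child (F : Frame d) (p : List (Fin d)) (x : ℕ → Fin d) :
    emb (F.child p) x = emb F (prepend p x) := by
  rw [Frame.child, emb, emb, prepend_map, prepend_append]

theorem cylinder_child_subset (F : Frame d) (p : List (Fin d)) :
    cylinder (F.child p).1 ⊆ cylinder F.1 := cylinder_append_subset _ _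

theorem actsAs_iff_maps {g : (ℕ → Fin d) ≃ₜ (ℕ → Fin d)} {v u : List (Fin d)}
    {s : Equiv.Perm (Fin d)} : ActsAs g v u s ↔ Maps g (v, 1) (u, s) := Iff.rfl

theorem Maps.child {g : (ℕ → Fin d) ≃ₜ (ℕ → Fin d)} {F G : Frame d} (h : Maps g F G)
    (p : List (Fin d)) : Maps g (F.child p) (G.child p) := fun x => by
  rw [emb_child, emb_child, h]

theorem Maps.comp {g f : (ℕ → Fin d) ≃ₜ (ℕ → Fin d)} {F G K : Frame d} (hg : Maps g G K)
    (hf : Maps f F G) : Maps (g * f) F K := fun x => by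
  rw [Homeomorph.mul_apply, hf, hg]

theorem Maps.image {g : (ℕ → Fin d) ≃ₜ (ℕ → Fin d)} {F G : Frame d} (h : Maps g F G) :
    g '' cylinder F.1 = cylinder G.1 := by
  ext y
  constructor
  · rintro ⟨x, hx, rfl⟩
    obtain ⟨z, rfl⟩ := mem_cylinder_iff_emb.1 hx
    rw [h]; exact emb_mem _ _
  · intro hy
    obtain ⟨z, rfl⟩ := mem_cylinder_iff_emb.1 hy
    exact ⟨_, emb_mem F z, h z⟩

theorem maps_of_forall_mem {g : (ℕ → Fin d) ≃ₜ (ℕ → Fin d)} {F : Frame d}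
    (h : ∀ x ∈ cylinder F.1, g x = x) : Maps g F F := fun x => h _ (emb_mem F x)

theorem mem_V_iff {H : Subgroup (Equiv.Perm (Fin d))} {g : (ℕ → Fin d) ≃ₜ (ℕ → Fin d)} :
    g ∈ V d H ↔ ∀ x, ∃ v u : List (Fin d), ∃ s ∈ H, x ∈ cylinder v ∧ ActsAs g v u s := Iff.rfl

end Frames

/-! ### Permutations of families of disjoint framed cylinders -/

section PermHom

variable {d : ℕ} {H : Subgroup (Equiv.Perm (Fin d))} {ι : Type*}

/-- A family of framed cylinders that are pairwise disjoint and whose letter permutations lie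
in `H`. -/
structure IsFamily (H : Subgroup (Equiv.Perm (Fin d))) (F : ι → Frame d) : Prop where
  disj : Pairwise (Disjoint on fun i => cylinder (F i).1)
  mem : ∀ i, (F i).2 ∈ H

theorem IsFamily.eq_of_emb_eq {F : ι → Frame d} (hF : IsFamily H F) {i j : ι}
    {x y : ℕ → Fin d} (h : emb (F i) x = emb (F j) y) : i = j ∧ x = y := by
  have hij : i = j := by
    by_contra hne
    exact Set.disjoint_left.1 (hF.disj hne) (emb_mem (F i) x) (h ▸ emb_mem (F j) y)
  subst hij
  exact ⟨rfl, emb_injective _ h⟩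

theorem IsFamily.comp {κ : Type*} {F : ι → Frame d} (hF : IsFamily H F) {f : κ → ι}
    (hf : Injective f) : IsFamily H (F ∘ f) :=
  ⟨fun _ _ hij => hF.disj (hf.ne hij), fun i => hF.mem (f i)⟩

theorem IsFamily.map_maps {F G : ι → Frame d} (hF : IsFamily H F)
    {g : (ℕ → Fin d) ≃ₜ (ℕ → Fin d)} (hg : ∀ i, Maps g (F i) (G i)) (hG : ∀ i, (G i).2 ∈ H) :
    IsFamily H G := by
  refine ⟨fun i j hij => ?_, hG⟩
  have := (disjoint_image_iff g.injective).2 (hF.disj hij)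
  simpa only [Function.onFun, (hg i).image, (hg j).image] using this

open Classical in
/-- The map `emb (F i) y ↦ emb (F (σ i)) y`, extended by the identity. It is well defined when the
cylinders of the family are disjoint. -/
noncomputable def permFun (F : ι → Frame d) (σ : Equiv.Perm ι) (x : ℕ → Fin d) : ℕ → Fin d :=
  if h : ∃ p : ι × (ℕ → Fin d), emb (F p.1) p.2 = x then
    emb (F (σ h.choose.1)) h.choose.2 else x

theorem permFun_emb {F : ι → Frame d} (hF : IsFamily H F) (σ : Equiv.Perm ι) (i : ι)
    (y : ℕ → Fin d) : permFun F σ (emb (F i) y) = emb (F (σ i)) y := by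
  have h : ∃ p : ι × (ℕ → Fin d), emb (F p.1) p.2 = emb (F i) y := ⟨(i, y), rfl⟩
  rw [permFun, dif_pos h]
  obtain ⟨h1, h2⟩ := hF.eq_of_emb_eq h.choose_spec
  rw [h1, h2]

theorem permFun_of_notMem {F : ι → Frame d} (σ : Equiv.Perm ι) {x : ℕ → Fin d}
    (hx : x ∉ ⋃ i, cylinder (F i).1) : permFun F σ x = x := by
  rw [permFun, dif_neg]
  rintro ⟨p, rfl⟩
  exact hx (mem_iUnion.2 ⟨p.1, emb_mem _ _⟩)

theorem permFun_mul {F : ι → Frame d} (hF : IsFamily H F) (σ τ : Equiv.Perm ι)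
    (x : ℕ → Fin d) : permFun F (σ * τ) x = permFun F σ (permFun F τ x) := by
  by_cases hx : x ∈ ⋃ i, cylinder (F i).1
  · obtain ⟨i, hi⟩ := mem_iUnion.1 hx
    obtain ⟨y, rfl⟩ := mem_cylinder_iff_emb.1 hi
    simp [permFun_emb hF]
  · simp [permFun_of_notMem _ hx]

theorem permFun_one {F : ι → Frame d} (hF : IsFamily H F) (x : ℕ → Fin d) :
    permFun F 1 x = x := by
  by_cases hx : x ∈ ⋃ i, cylinder (F i).1
  · obtain ⟨i, hi⟩ := mem_iUnion.1 hx
    obtain ⟨y, rfl⟩ := mem_cylinder_iff_emb.1 hi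
    simp [permFun_emb hF]
  · simp [permFun_of_notMem _ hx]

theorem exists_permFun_prepend [Finite ι] {F : ι → Frame d} (hF : IsFamily H F)
    (σ : Equiv.Perm ι) (x : ℕ → Fin d) :
    ∃ v u : List (Fin d), ∃ s ∈ H, x ∈ cylinder v ∧
      ∀ y, permFun F σ (prepend v y) = prepend u (s ∘ y) := by
  by_cases hx : x ∈ ⋃ i, cylinder (F i).1
  · obtain ⟨i, hi⟩ := mem_iUnion.1 hx
    refine ⟨(F i).1, (F (σ i)).1, (F (σ i)).2 * (F i).2⁻¹,
      H.mul_mem (hF.mem _) (H.inv_mem (hF.mem _)), hi, fun y => ?_⟩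
    have := permFun_emb hF σ i (⇑(F i).2⁻¹ ∘ y)
    rw [emb, perm_comp_inv_comp] at this
    exact this
  · have hc : IsClosed (⋃ i, cylinder (F i).1) := isClosed_iUnion_of_finite fun i =>
      isClosed_cylinder _
    obtain ⟨v, hxv, hv⟩ := exists_cylinder_subset hc.isOpen_compl hx
    exact ⟨v, v, 1, H.one_mem, hxv, fun y =>
      permFun_of_notMem σ (hv (prepend_mem_cylinder v y))⟩

theorem continuous_of_forall_exists_prepend {f : (ℕ → Fin d) → (ℕ → Fin d)}
    (h : ∀ x, ∃ v u : List (Fin d), ∃ s : Equiv.Perm (Fin d), x ∈ cylinder v ∧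
      ∀ y, f (prepend v y) = prepend u (s ∘ y)) : Continuous f := by
  rw [continuous_iff_continuousAt]
  intro x
  obtain ⟨v, u, s, hx, hf⟩ := h x
  refine ContinuousOn.continuousAt (s := cylinder v) ?_ ((isOpen_cylinder v).mem_nhds hx)
  have hc : Continuous fun z : ℕ → Fin d => prepend u (s ∘ fun n => z (v.length + n)) :=
    (continuous_prepend u).comp (continuous_pi fun n =>
      (continuous_of_discreteTopology (f := s)).comp (continuous_apply _))
  refine hc.continuousOn.congr ?_
  rintro _ ⟨y, rfl⟩
  rw [hf]
  congr 2
  funext n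
  rw [prepend_apply_add]

/-- A bijection that is locally a similarity with letter permutation in `H`, as an element of
`V d H`; its continuity is automatic, and so is that of its inverse, by compactness. -/
def ofEquiv (e : (ℕ → Fin d) ≃ (ℕ → Fin d)) (h : ∀ x, ∃ v u : List (Fin d), ∃ s ∈ H,
    x ∈ cylinder v ∧ ∀ y, e (prepend v y) = prepend u (s ∘ y)) : V d H :=
  ⟨Continuous.homeoOfEquivCompactToT2 (f := e) (continuous_of_forall_exists_prepend fun x => by
      obtain ⟨v, u, s, -, hx, hf⟩ := h x
      exact ⟨v, u, s, hx, hf⟩), h⟩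

/-- The action of the symmetric group of the index set on a family of disjoint framed
cylinders, as a homomorphism to `V d H`. -/
noncomputable def permHom [Finite ι] {F : ι → Frame d} (hF : IsFamily H F) :
    Equiv.Perm ι →* V d H where
  toFun σ := ofEquiv
    { toFun := permFun F σ
      invFun := permFun F σ⁻¹
      left_inv := fun x => by rw [← permFun_mul hF, inv_mul_cancel, permFun_one hF]
      right_inv := fun x => by rw [← permFun_mul hF, mul_inv_cancel, permFun_one hF] }
    (exists_permFun_prepend hF σ)
  map_one' := Subtype.ext (Homeomorph.ext (permFun_one hF))
  map_mul' σ τ := Subtype.ext (Homeomorph.ext (permFun_mul hF σ τ))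

theorem permHom_maps [Finite ι] {F : ι → Frame d} (hF : IsFamily H F) (σ : Equiv.Perm ι)
    (i : ι) : Maps (permHom hF σ : (ℕ → Fin d) ≃ₜ (ℕ → Fin d)) (F i) (F (σ i)) :=
  fun x => permFun_emb hF σ i x

theorem permHom_apply_of_notMem [Finite ι] {F : ι → Frame d} (hF : IsFamily H F)
    (σ : Equiv.Perm ι) {x : ℕ → Fin d} (hx : x ∉ ⋃ i, cylinder (F i).1) :
    (permHom hF σ : (ℕ → Fin d) ≃ₜ (ℕ → Fin d)) x = x :=
  permFun_of_notMem σ hx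

/-- An element that carries a family `F` to a family `G` conjugates the permutations of `F` to
those of `G`. -/
theorem permHom_conj [Finite ι] {F G : ι → Frame d} (hF : IsFamily H F) (hG : IsFamily H G)
    {g : V d H} (hg : ∀ i, Maps (g : (ℕ → Fin d) ≃ₜ (ℕ → Fin d)) (F i) (G i))
    (σ : Equiv.Perm ι) : g * permHom hF σ * g⁻¹ = permHom hG σ := by
  rw [mul_inv_eq_iff_eq_mul]
  refine Subtype.ext (Homeomorph.ext fun x => ?_)
  change (g : (ℕ → Fin d) ≃ₜ (ℕ → Fin d)) (permFun F σ x) =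
    permFun G σ ((g : (ℕ → Fin d) ≃ₜ (ℕ → Fin d)) x)
  by_cases hx : x ∈ ⋃ i, cylinder (F i).1
  · obtain ⟨i, hi⟩ := mem_iUnion.1 hx
    obtain ⟨y, rfl⟩ := mem_cylinder_iff_emb.1 hi
    rw [permFun_emb hF, hg, hg, permFun_emb hG]
  · rw [permFun_of_notMem _ hx, permFun_of_notMem]
    simp only [mem_iUnion, ← (hg _).image] at hx ⊢
    rintro ⟨i, y, hy, hyx⟩
    rw [(EquivLike.injective (g : (ℕ → Fin d) ≃ₜ (ℕ → Fin d))) hyx] at hy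
    exact hx ⟨i, hy⟩

end PermHom

/-! ### The alternating subgroup and its transitivity -/

section Alternating

variable {d : ℕ} {H : Subgroup (Equiv.Perm (Fin d))} {ι κ : Type*}

/-- The subgroup of `V d H` generated by the even permutations of five disjoint framed cylinders
that do not cover the whole space. -/
def altV (H : Subgroup (Equiv.Perm (Fin d))) : Subgroup (V d H) :=
  Subgroup.closure {g | ∃ (F : Fin 5 → Frame d) (hF : IsFamily H F),
    (⋃ i, cylinder (F i).1) ≠ univ ∧ ∃ σ ∈ alternatingGroup (Fin 5), permHom hF σ = g}

theorem IsFamily.sumElim {F : ι → Frame d} {G : κ → Frame d} (hF : IsFamily H F)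
    (hG : IsFamily H G) (h : ∀ i j, Disjoint (cylinder (F i).1) (cylinder (G j).1)) :
    IsFamily H (Sum.elim F G) := by
  constructor
  · rintro (i | i) (j | j) hij
    · exact hF.disj fun h => hij (by rw [h])
    · exact h i j
    · exact (h j i).symm
    · exact hG.disj fun h => hij (by rw [h])
  · rintro (i | i)
    · exact hF.mem i
    · exact hG.mem i

/-- The frames `(w ++ p k, 1)` inside the cylinder of `w`. -/
theorem isFamily_append {p : ℕ → List (Fin d)} (hp : Pairwise (Disjoint on fun i => cylinder (p i)))
    (w : List (Fin d)) : IsFamily H fun k : ℕ => ((w ++ p k, 1) : Frame d) :=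
  ⟨fun _ _ hij => disjoint_cylinder_append w (hp hij), fun _ => H.one_mem⟩

theorem IsFamily.notMem {K : κ → Frame d} (hK : IsFamily H K) {f : ι → κ} {k : κ}
    (hk : k ∉ range f) {x : ℕ → Fin d} (hx : x ∈ cylinder (K k).1) :
    x ∉ ⋃ i, cylinder ((K ∘ f) i).1 := by
  intro h
  obtain ⟨i, hi⟩ := mem_iUnion.1 h
  refine Set.disjoint_left.1 (hK.disj fun h => hk ⟨i, h⟩) hi hx

theorem permHom_mem_altV {F : Fin 5 → Frame d} (hF : IsFamily H F)
    (h : (⋃ i, cylinder (F i).1) ≠ univ) {σ : Equiv.Perm (Fin 5)}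
    (hσ : σ ∈ alternatingGroup (Fin 5)) : permHom hF σ ∈ altV H :=
  Subgroup.subset_closure ⟨F, hF, h, σ, hσ, rfl⟩

theorem ActsAs.append {g : (ℕ → Fin d) ≃ₜ (ℕ → Fin d)} {v u : List (Fin d)}
    {s : Equiv.Perm (Fin d)} (h : ActsAs g v u s) (p : List (Fin d)) :
    ActsAs g (v ++ p) (u ++ p.map s) s := fun x => by
  rw [prepend_append, h, prepend_map, prepend_append]

theorem disjoint_cylinder_of_length_eq {v w : List (Fin d)} (h : v.length = w.length)
    (hne : v ≠ w) : Disjoint (cylinder v) (cylinder w) := by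
  rw [Set.disjoint_left]
  rintro _ ⟨x, rfl⟩ ⟨y, hy⟩
  rcases prepend_eq_prepend _ _ _ _ hy with ⟨p, rfl, -⟩ | ⟨p, rfl, -⟩ <;>
  · have : p = [] := by
      rw [List.length_append] at h
      exact List.length_eq_zero_iff.1 (by omega)
    simp [this] at hne

theorem permHom_conj_eq_of_fixes [Finite ι] {F : ι → Frame d} (hF : IsFamily H F) {r : V d H}
    (hr : ∀ x ∈ ⋃ i, cylinder (F i).1, (r : (ℕ → Fin d) ≃ₜ (ℕ → Fin d)) x = x)
    (σ : Equiv.Perm ι) : r * permHom hF σ * r⁻¹ = permHom hF σ :=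
  permHom_conj hF hF (fun i => maps_of_forall_mem fun x hx => hr x (mem_iUnion.2 ⟨i, hx⟩)) σ

theorem commute_of_disjoint {f g : V d H} {A B : Set (ℕ → Fin d)} (hAB : Disjoint A B)
    (hf : ∀ x ∉ A, (f : (ℕ → Fin d) ≃ₜ (ℕ → Fin d)) x = x)
    (hg : ∀ x ∉ B, (g : (ℕ → Fin d) ≃ₜ (ℕ → Fin d)) x = x) : Commute f g := by
  -- a homeomorphism that is the identity off a set preserves that set
  have key : ∀ {f : (ℕ → Fin d) ≃ₜ (ℕ → Fin d)} {A : Set (ℕ → Fin d)}, (∀ x ∉ A, f x = x) →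
      ∀ x ∈ A, f x ∈ A := by
    intro f A hf x hx
    by_contra h
    have := f.injective (hf _ h)
    exact h (by rwa [this])
  refine Subtype.ext (Homeomorph.ext fun x => ?_)
  change f.1 (g.1 x) = g.1 (f.1 x)
  by_cases hA : x ∈ A
  · rw [hg x (Set.disjoint_left.1 hAB hA), hg _ (Set.disjoint_left.1 hAB (key hf x hA))]
  · by_cases hB : x ∈ B
    · rw [hf x hA, hf _ (Set.disjoint_right.1 hAB (key hg x hB))]
    · rw [hf x hA, hg x hB, hf x hA]

variable [Nontrivial (Fin d)]

theorem nonempty_cylinder (v : List (Fin d)) : (cylinder v).Nonempty :=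
  ⟨_, prepend_mem_cylinder v fun _ => (exists_pair_ne (Fin d)).choose⟩

theorem IsFamily.iUnion_ne_univ {K : κ → Frame d} (hK : IsFamily H K) {f : ι → κ} {k : κ}
    (hk : k ∉ range f) : (⋃ i, cylinder ((K ∘ f) i).1) ≠ univ := by
  obtain ⟨x, hx⟩ := nonempty_cylinder (K k).1
  exact fun h => hK.notMem hk hx (h ▸ mem_univ x)

/-- A finite subfamily `i ↦ K (inl (inl i))` is carried to another one, disjoint from it, by a
product of double transpositions, the second transposition of each being taken in the spare
part `k ↦ K (inr k)` of the family. -/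
theorem exists_altV_maps_of_disjoint [Finite ι] {K : (ι ⊕ ι) ⊕ ℕ → Frame d} (hK : IsFamily H K) :
    ∃ e ∈ altV H, ∀ i, Maps (e : (ℕ → Fin d) ≃ₜ (ℕ → Fin d)) (K (.inl (.inl i)))
      (K (.inl (.inr i))) := by
  classical
  have := Fintype.ofFinite ι
  suffices h : ∀ s : Finset ι, ∃ e ∈ altV H,
      (∀ i ∈ s, Maps (e : (ℕ → Fin d) ≃ₜ (ℕ → Fin d)) (K (.inl (.inl i))) (K (.inl (.inr i)))) ∧
      ∀ i ∉ s, Maps (e : (ℕ → Fin d) ≃ₜ (ℕ → Fin d)) (K (.inl (.inl i))) (K (.inl (.inl i))) by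
    obtain ⟨e, he, h1, -⟩ := h Finset.univ
    exact ⟨e, he, fun i => h1 i (Finset.mem_univ i)⟩
  intro s
  induction s using Finset.induction_on with
  | empty => exact ⟨1, one_mem _, by simp, fun i _ x => rfl⟩
  | insert i s hi ih =>
    obtain ⟨e, he, h1, h2⟩ := ih
    let f : Fin 5 → (ι ⊕ ι) ⊕ ℕ := ![.inl (.inl i), .inl (.inr i), .inr 0, .inr 1, .inr 2]
    have hf : Injective f := by
      intro a b
      fin_cases a <;> fin_cases b <;> simp [f]
    have hf3 : Sum.inr 3 ∉ range f := by
      rintro ⟨a, ha⟩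
      fin_cases a <;> simp [f] at ha
    let σ : Equiv.Perm (Fin 5) := Equiv.swap 0 1 * Equiv.swap 2 3
    have hσ : σ ∈ alternatingGroup (Fin 5) := by
      rw [Equiv.Perm.mem_alternatingGroup]; decide
    have hfix : ∀ k ∉ range f, Maps (permHom (hK.comp hf) σ : (ℕ → Fin d) ≃ₜ (ℕ → Fin d))
        (K k) (K k) := fun k hk => maps_of_forall_mem fun x hx =>
      permHom_apply_of_notMem _ _ (hK.notMem hk hx)
    refine ⟨permHom (hK.comp hf) σ * e,
      mul_mem (permHom_mem_altV _ (hK.iUnion_ne_univ hf3) hσ) he, ?_, ?_⟩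
    · intro j hj
      rcases Finset.mem_insert.1 hj with rfl | hj
      · have := permHom_maps (hK.comp hf) σ 0
        have hs : σ 0 = 1 := by decide
        rw [hs] at this
        exact Maps.comp this (h2 j hi)
      · refine Maps.comp (hfix _ ?_) (h1 j hj)
        rintro ⟨a, ha⟩
        have hij : i ≠ j := fun h => hi (h ▸ hj)
        fin_cases a <;> simp [f, hij] at ha
    · intro j hj
      rw [Finset.mem_insert, not_or] at hj
      refine Maps.comp (hfix _ ?_) (h2 j hj.2)
      rintro ⟨a, ha⟩
      have hij : i ≠ j := fun h => hj.1 h.symm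
      fin_cases a <;> simp [f, hij] at ha

/-- The alternating subgroup acts transitively on the finite families of disjoint framed
cylinders of a given size that do not cover the space. A family is moved first into a cylinder
that misses it, then into a cylinder that misses the target family, then to the target. -/
theorem exists_altV_maps [Finite ι] {F F' : ι → Frame d} (hF : IsFamily H F) (hF' : IsFamily H F')
    (hn : (⋃ i, cylinder (F i).1) ≠ univ) (hn' : (⋃ i, cylinder (F' i).1) ≠ univ) :
    ∃ e ∈ altV H, ∀ i, Maps (e : (ℕ → Fin d) ≃ₜ (ℕ → Fin d)) (F i) (F' i) := by
  have hc : ∀ {F : ι → Frame d}, IsOpen (⋃ i, cylinder (F i).1)ᶜ := fun {F} =>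
    (isClosed_iUnion_of_finite fun i => isClosed_cylinder _).isOpen_compl
  obtain ⟨w, w', hw, hw', hww⟩ := exists_disjoint_cylinders hc (nonempty_compl.2 hn) hc
    (nonempty_compl.2 hn')
  obtain ⟨p, hp⟩ := exists_pairwise_disjoint_cylinders (d := d)
  obtain ⟨n, hnj⟩ := exists_injective_nat (ι ⊕ ℕ)
  have hW := isFamily_append (H := H) hp w
  have hW' := isFamily_append (H := H) hp w'
  have h1 := hF.sumElim hW fun i j => ((subset_compl_iff_disjoint_left.1
    (hw.trans (compl_subset_compl.2 (subset_iUnion _ i))))).mono_right (cylinder_append_subset _ _)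
  have h2 := hW.sumElim hW' fun i j => hww.mono (cylinder_append_subset _ _)
    (cylinder_append_subset _ _)
  have h3 := hF'.sumElim hW' fun i j => ((subset_compl_iff_disjoint_left.1
    (hw'.trans (compl_subset_compl.2 (subset_iUnion _ i))))).mono_right (cylinder_append_subset _ _)
  have i1 : Injective (Sum.elim (Sum.elim Sum.inl fun i => Sum.inr (n (.inl i)))
      (fun k => Sum.inr (n (.inr k))) : (ι ⊕ ι) ⊕ ℕ → ι ⊕ ℕ) := by
    rintro ((a | a) | a) ((b | b) | b) <;> simp [hnj.eq_iff]
  have i2 : Injective (Sum.elim (Sum.elim (fun i => Sum.inl (n (.inl i)))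
      fun i => Sum.inr (n (.inl i)))
      (fun k => Sum.inl (n (.inr k))) : (ι ⊕ ι) ⊕ ℕ → ℕ ⊕ ℕ) := by
    rintro ((a | a) | a) ((b | b) | b) <;> simp [hnj.eq_iff]
  have i3 : Injective (Sum.elim (Sum.elim (fun i => Sum.inr (n (.inl i))) Sum.inl)
      (fun k => Sum.inr (n (.inr k))) : (ι ⊕ ι) ⊕ ℕ → ι ⊕ ℕ) := by
    rintro ((a | a) | a) ((b | b) | b) <;> simp [hnj.eq_iff]
  obtain ⟨e1, he1, hm1⟩ := exists_altV_maps_of_disjoint (h1.comp i1)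
  obtain ⟨e2, he2, hm2⟩ := exists_altV_maps_of_disjoint (h2.comp i2)
  obtain ⟨e3, he3, hm3⟩ := exists_altV_maps_of_disjoint (h3.comp i3)
  exact ⟨e3 * (e2 * e1), mul_mem he3 (mul_mem he2 he1), fun i =>
    Maps.comp (hm3 i) (Maps.comp (hm2 i) (hm1 i))⟩

/-! ### The quotient by the alternating subgroup is abelian -/

/-- By compactness, an element of `V d H` acts as a similarity on all cylinders of sufficiently
long words. -/
theorem exists_forall_actsAs (g : V d H) : ∃ N, ∀ v : List (Fin d), N ≤ v.length →
    ∃ u, ∃ s ∈ H, ActsAs (g : (ℕ → Fin d) ≃ₜ (ℕ → Fin d)) v u s := by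
  choose v u s hs hx ha using mem_V_iff.1 g.2
  obtain ⟨t, -, ht⟩ := (isCompact_univ (X := ℕ → Fin d)).elim_nhds_subcover
    (fun x => cylinder (v x)) fun x _ => (isOpen_cylinder _).mem_nhds (hx x)
  refine ⟨t.sup fun x => (v x).length, fun w hw => ?_⟩
  obtain ⟨y, z, rfl⟩ := nonempty_cylinder w
  obtain ⟨x, hxt, y, hy⟩ := mem_iUnion₂.1 (ht (mem_univ (prepend w z)))
  have hl : (v x).length ≤ w.length :=
    (Finset.le_sup (f := fun x => (v x).length) hxt).trans hw
  rcases prepend_eq_prepend _ _ _ _ hy with ⟨p, rfl, -⟩ | ⟨p, hp, -⟩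
  · exact ⟨_, _, hs x, (ha x).append p⟩
  · have : p = [] := by
      rw [hp, List.length_append] at hl
      exact List.length_eq_zero_iff.1 (by omega)
    rw [this, List.append_nil] at hp
    exact ⟨_, _, hs x, hp ▸ ha x⟩

/-- Outside a given cylinder every element of `V d H` agrees with an element of the alternating
subgroup. -/
theorem exists_altV_eq_off (g : V d H) (z : List (Fin d)) :
    ∃ e ∈ altV H, ∀ x ∉ cylinder z, (e : (ℕ → Fin d) ≃ₜ (ℕ → Fin d)) x =
      (g : (ℕ → Fin d) ≃ₜ (ℕ → Fin d)) x := by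
  obtain ⟨N, hN⟩ := exists_forall_actsAs g
  let n := max N z.length
  let ι := {f : Fin n → Fin d // Disjoint (cylinder (List.ofFn f)) (cylinder z)}
  let F : ι → Frame d := fun f => (List.ofFn f.1, 1)
  choose u s hs ha using fun f : ι => hN (List.ofFn f.1) (by simp [n])
  have hF : IsFamily H F := ⟨fun f f' hff => disjoint_cylinder_of_length_eq (by simp [F])
    fun h => hff (Subtype.ext (List.ofFn_injective h)), fun _ => H.one_mem⟩
  have hn : (⋃ i, cylinder (F i).1) ⊆ (cylinder z)ᶜ := iUnion_subset fun f =>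
    subset_compl_iff_disjoint_right.2 f.2
  have hg : ∀ f : ι, Maps (g : (ℕ → Fin d) ≃ₜ (ℕ → Fin d)) (F f) (u f, s f) := ha
  obtain ⟨y, hy⟩ := nonempty_cylinder z
  obtain ⟨e, he, hm⟩ := exists_altV_maps hF (hF.map_maps hg hs)
    (fun h => hn (h ▸ mem_univ y) hy) (by
      intro h
      obtain ⟨i, hi⟩ := mem_iUnion.1 (h ▸ mem_univ (g.1 y))
      rw [← (hg i).image] at hi
      obtain ⟨x, hx, hxy⟩ := hi
      rw [g.1.injective hxy] at hx
      exact hn (mem_iUnion.2 ⟨i, hx⟩) hy)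
  refine ⟨e, he, fun x hx => ?_⟩
  have hd : Disjoint (cylinder (List.ofFn fun i : Fin n => x i)) (cylinder z) := by
    rw [Set.disjoint_left]
    intro y hy hyz
    rw [cylinder_ofFn, PiNat.mem_cylinder_iff] at hy
    refine hx (mem_cylinder_iff.2 fun k hk => ?_)
    rw [← hy k (lt_of_lt_of_le hk (le_max_right _ _))]
    exact mem_cylinder_iff.1 hyz k hk
  have hxF : x ∈ cylinder (F ⟨_, hd⟩).1 := by
    simp only [F, cylinder_ofFn]
    exact PiNat.self_mem_cylinder x n
  obtain ⟨y, hy⟩ := mem_cylinder_iff_emb.1 hxF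
  rw [← hy, hm, hg]

instance altV_normal : (altV H).Normal := by
  refine ⟨fun c hc g => ?_⟩
  suffices h : altV H ≤ (altV H).comap (MulAut.conj g).toMonoidHom from h hc
  refine (Subgroup.closure_le _).2 ?_
  rintro _ ⟨F, hF, hn, σ, hσ, rfl⟩
  have hc : IsOpen (⋃ i, cylinder (F i).1)ᶜ :=
    (isClosed_iUnion_of_finite fun i => isClosed_cylinder _).isOpen_compl
  obtain ⟨x, hx⟩ := nonempty_compl.2 hn
  obtain ⟨z, -, hz⟩ := exists_cylinder_subset hc hx
  obtain ⟨e, he, heg⟩ := exists_altV_eq_off g z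
  -- `g` and `e` agree on the support of the generator, so they conjugate it to the same element
  have hr : (e⁻¹ * g) * permHom hF σ * (e⁻¹ * g)⁻¹ = permHom hF σ := by
    refine permHom_conj_eq_of_fixes hF (fun y hy => ?_) σ
    have := heg y fun h => hz h hy
    change e.1.symm (g.1 y) = y
    rw [← this, Homeomorph.symm_apply_apply]
  have : g * permHom hF σ * g⁻¹ = e * permHom hF σ * e⁻¹ := by
    conv_rhs => rw [← hr]
    group
  change g * permHom hF σ * g⁻¹ ∈ altV H
  rw [this]
  exact mul_mem (mul_mem he (permHom_mem_altV hF hn hσ)) (inv_mem he)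

/-- Modulo the alternating subgroup two elements can be moved into disjoint cylinders, where
they commute. -/
theorem commutator_mem_altV (g g' : V d H) : ⁅g, g'⁆ ∈ altV H := by
  obtain ⟨z, z', -, -, hz⟩ := exists_disjoint_cylinders (d := d) isOpen_univ
    ⟨_, mem_univ fun _ => (exists_pair_ne (Fin d)).choose⟩ isOpen_univ
    ⟨_, mem_univ fun _ => (exists_pair_ne (Fin d)).choose⟩
  obtain ⟨e, he, heg⟩ := exists_altV_eq_off g z
  obtain ⟨e', he', heg'⟩ := exists_altV_eq_off g' z'
  have hcomm : Commute (e⁻¹ * g) (e'⁻¹ * g') := commute_of_disjoint hz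
    (fun x hx => (congrArg e.1.symm (heg x hx).symm).trans (e.1.symm_apply_apply x))
    (fun x hx => (congrArg e'.1.symm (heg' x hx).symm).trans (e'.1.symm_apply_apply x))
  rw [← QuotientGroup.eq_one_iff]
  have h := congrArg (QuotientGroup.mk' (altV H)) hcomm.eq
  have h1 : QuotientGroup.mk' (altV H) e = 1 := (QuotientGroup.eq_one_iff e).2 he
  have h1' : QuotientGroup.mk' (altV H) e' = 1 := (QuotientGroup.eq_one_iff e').2 he'
  rw [map_mul, map_mul, map_mul, map_mul, map_mul, map_mul, map_inv, map_inv, h1, h1', inv_one,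
    one_mul, one_mul] at h
  change QuotientGroup.mk' (altV H) ⁅g, g'⁆ = 1
  rw [map_commutatorElement]
  exact commutatorElement_eq_one_iff_mul_comm.2 h

end Alternating

/-! ### Simplicity of the alternating subgroup -/

section Simple

variable {d : ℕ} {H : Subgroup (Equiv.Perm (Fin d))}

theorem permHom_injective [Nontrivial (Fin d)] {ι : Type*} [Finite ι] {F : ι → Frame d}
    (hF : IsFamily H F) : Injective (permHom hF) := fun σ τ h => Equiv.ext fun i => by
  have h1 := permHom_maps hF σ i fun _ => (exists_pair_ne (Fin d)).choose
  rw [h, permHom_maps hF τ i] at h1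
  exact (hF.eq_of_emb_eq h1).1.symm

theorem commutatorElement_mul_inv_eq {G : Type*} [Group G] {a b c : G} (h1 : Commute c a)
    (h2 : Commute c b) : ⁅c * a⁻¹, b⁆ = ⁅a⁻¹, b⁆ := by
  have h3 : Commute c ⁅a⁻¹, b⁆ := by
    rw [commutatorElement_def]
    exact ((h1.inv_right.mul_right h2).mul_right h1.inv_right.inv_right).mul_right h2.inv_right
  calc ⁅c * a⁻¹, b⁆ = c * (a⁻¹ * b * a⁻¹⁻¹) * c⁻¹ * b⁻¹ := by
        rw [commutatorElement_def, mul_inv_rev]; group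
    _ = c * ⁅a⁻¹, b⁆ * (b * c⁻¹ * b⁻¹) := by rw [commutatorElement_def]; group
    _ = c * ⁅a⁻¹, b⁆ * c⁻¹ := by rw [← h2.inv_left.eq]; group
    _ = ⁅a⁻¹, b⁆ := by rw [h3.eq, mul_inv_cancel_right]

variable [Nontrivial (Fin d)]

/-- Five disjoint framed cylinders inside a given cylinder that do not cover it. -/
theorem exists_family_subset (H : Subgroup (Equiv.Perm (Fin d))) (v : List (Fin d)) :
    ∃ F : Fin 5 → Frame d, IsFamily H F ∧ (⋃ i, cylinder (F i).1) ≠ univ ∧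
      (⋃ i, cylinder (F i).1) ⊆ cylinder v := by
  obtain ⟨p, hp⟩ := exists_pairwise_disjoint_cylinders (d := d)
  have hW := isFamily_append (H := H) hp v
  refine ⟨_, hW.comp Fin.val_injective, hW.iUnion_ne_univ (k := 5) ?_, ?_⟩
  · rintro ⟨i, hi⟩
    omega
  · exact iUnion_subset fun i => cylinder_append_subset _ _

/-- The double commutator argument: a nontrivial subgroup normalized by the alternating subgroup
contains it. An element `g` of the subgroup moves some cylinder off itself; for `a`, `b` supported
in that cylinder `⁅⁅g, a⁆, b⁆ = ⁅a⁻¹, b⁆`. So the subgroup meets the copy of `A₅` acting on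
five subcylinders nontrivially, hence contains it, and all such copies are conjugate. -/
theorem altV_le_of_conj_mem (N : Subgroup (V d H)) (hN : ∀ e ∈ altV H, ∀ n ∈ N, e * n * e⁻¹ ∈ N)
    (hne : N ≠ ⊥) : altV H ≤ N := by
  obtain ⟨g, hg, hg1⟩ := N.bot_or_exists_ne_one.resolve_left hne
  obtain ⟨x, hx⟩ : ∃ x, g.1 x ≠ x := by
    by_contra! h
    exact hg1 (Subtype.ext (Homeomorph.ext h))
  obtain ⟨A, B, hA, hB, hxA, hxB, hAB⟩ := t2_separation hx
  obtain ⟨v, -, hv⟩ := exists_cylinder_subset (hB.inter (hA.preimage g.1.continuous)) ⟨hxB, hxA⟩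
  have hgv : Disjoint (g.1 '' cylinder v) (cylinder v) :=
    hAB.mono (image_subset_iff.2 fun y hy => (hv hy).2) fun y hy => (hv hy).1
  obtain ⟨F, hF, hn, hFv⟩ := exists_family_subset H v
  have hsupp : ∀ σ, ∀ y ∉ cylinder v, (permHom hF σ).1 y = y := fun σ y hy =>
    permHom_apply_of_notMem hF σ fun h => hy (hFv h)
  have hsupp' : ∀ σ, ∀ y ∉ g.1 '' cylinder v, (g * permHom hF σ * g⁻¹).1 y = y := by
    intro σ y hy
    change g.1 ((permHom hF σ).1 (g.1.symm y)) = y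
    rw [hsupp, Homeomorph.apply_symm_apply]
    exact fun h => hy ⟨_, h, g.1.apply_symm_apply y⟩
  have hcomm : ∀ σ ∈ alternatingGroup (Fin 5), ∀ τ ∈ alternatingGroup (Fin 5),
      permHom hF ⁅σ⁻¹, τ⁆ ∈ N := by
    intro σ hσ τ hτ
    have ha := permHom_mem_altV hF hn hσ
    have hb := permHom_mem_altV hF hn hτ
    set a := permHom hF σ with ha'
    set b := permHom hF τ with hb'
    have h1 : Commute (g * a * g⁻¹) a := commute_of_disjoint hgv (hsupp' σ) (hsupp σ)
    have h2 : Commute (g * a * g⁻¹) b := commute_of_disjoint hgv (hsupp' σ) (hsupp τ)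
    have hga : g * a * g⁻¹ * a⁻¹ ∈ N := by
      rw [mul_assoc, mul_assoc, ← mul_assoc a]
      exact N.mul_mem hg (hN a ha _ (N.inv_mem hg))
    rw [map_commutatorElement, map_inv, ← commutatorElement_mul_inv_eq h1 h2,
      commutatorElement_def, mul_assoc _ b, mul_assoc]
    exact N.mul_mem hga (hN b hb _ (N.inv_mem hga))
  let φ := (permHom hF).comp (alternatingGroup (Fin 5)).subtype
  let K : Subgroup (alternatingGroup (Fin 5)) := N.comap φ
  have hK : K.Normal := ⟨fun k hk a => by
    change φ (a * k * a⁻¹) ∈ N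
    rw [map_mul, map_mul, map_inv]
    exact hN _ (permHom_mem_altV hF hn a.2) _ hk⟩
  have hKtop : K = ⊤ := by
    refine (hK.eq_bot_or_eq_top).resolve_left fun h => ?_
    let σ : Equiv.Perm (Fin 5) := Equiv.swap 0 1 * Equiv.swap 1 2
    let τ : Equiv.Perm (Fin 5) := Equiv.swap 0 1 * Equiv.swap 1 3
    have hσ : σ ∈ alternatingGroup (Fin 5) := by rw [Equiv.Perm.mem_alternatingGroup]; decide
    have hτ : τ ∈ alternatingGroup (Fin 5) := by rw [Equiv.Perm.mem_alternatingGroup]; decide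
    have hmem : (⁅(⟨σ, hσ⟩ : alternatingGroup (Fin 5))⁻¹, ⟨τ, hτ⟩⁆) ∈ K := hcomm σ hσ τ hτ
    rw [h, Subgroup.mem_bot] at hmem
    have hne : ⁅σ⁻¹, τ⁆ ≠ 1 := by rw [commutatorElement_def]; decide
    exact hne (congrArg Subtype.val hmem)
  refine (Subgroup.closure_le _).2 ?_
  rintro _ ⟨F', hF', hn', σ, hσ, rfl⟩
  obtain ⟨e, he, hm⟩ := exists_altV_maps hF hF' hn hn'
  have hσN : (⟨σ, hσ⟩ : alternatingGroup (Fin 5)) ∈ K := hKtop ▸ Subgroup.mem_top _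
  rw [← permHom_conj hF hF' hm]
  exact hN e he _ hσN

theorem altV_not_commutative (H : Subgroup (Equiv.Perm (Fin d))) : ⁅altV H, altV H⁆ ≠ ⊥ := by
  obtain ⟨F, hF, hn, -⟩ := exists_family_subset H []
  let σ : Equiv.Perm (Fin 5) := Equiv.swap 0 1 * Equiv.swap 1 2
  let τ : Equiv.Perm (Fin 5) := Equiv.swap 0 1 * Equiv.swap 1 3
  have hσ : σ ∈ alternatingGroup (Fin 5) := by rw [Equiv.Perm.mem_alternatingGroup]; decide
  have hτ : τ ∈ alternatingGroup (Fin 5) := by rw [Equiv.Perm.mem_alternatingGroup]; decide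
  intro h
  have := Subgroup.commutator_mem_commutator (permHom_mem_altV hF hn hσ)
    (permHom_mem_altV hF hn hτ)
  rw [h, Subgroup.mem_bot, ← map_commutatorElement] at this
  have hne : ⁅σ, τ⁆ ≠ 1 := by rw [commutatorElement_def]; decide
  exact hne (permHom_injective hF (this.trans (map_one _).symm))

theorem commutator_altV (H : Subgroup (Equiv.Perm (Fin d))) : ⁅altV H, altV H⁆ = altV H :=
  le_antisymm (Subgroup.commutator_le_left _ _)
    (altV_le_of_conj_mem _ (fun e _ n hn => Subgroup.Normal.conj_mem inferInstance n hn e)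
      (altV_not_commutative H))

theorem isSimpleGroup_altV (H : Subgroup (Equiv.Perm (Fin d))) : IsSimpleGroup (altV H) := by
  have hnt : Nontrivial (altV H) := by
    rw [Subgroup.nontrivial_iff_ne_bot]
    intro h
    exact altV_not_commutative H (by rw [h, Subgroup.commutator_bot_left])
  refine { exists_pair_ne := hnt.exists_pair_ne, eq_bot_or_eq_top_of_normal := fun K hK => ?_ }
  by_cases h : K = ⊥
  · exact Or.inl h
  refine Or.inr (eq_top_iff.2 fun x _ => ?_)
  have hle : altV H ≤ K.map (altV H).subtype := by
    refine altV_le_of_conj_mem _ ?_ ?_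
    · rintro e he _ ⟨n, hn, rfl⟩
      exact ⟨_, hK.conj_mem n hn ⟨e, he⟩, rfl⟩
    · rwa [ne_eq, Subgroup.map_eq_bot_iff_of_injective _ (altV H).subtype_injective]
  obtain ⟨y, hy, hyx⟩ := hle x.2
  rwa [← Subtype.ext hyx]

/-- The commutator subgroup of any group between the alternating subgroup and `V d H` is the
alternating subgroup. -/
theorem commutator_eq_altV {V' : Subgroup (V d H)} (h : altV H ≤ V') : ⁅V', V'⁆ = altV H :=
  le_antisymm (Subgroup.commutator_le.2 fun g _ g' _ => commutator_mem_altV g g')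
    ((commutator_altV H).symm.le.trans (Subgroup.commutator_mono h h))

end Simple

/-! ### Partitions into cylinders -/

section Partitions

variable {d : ℕ}

/-- The cylinders of the words in the finite set `P` form a partition. -/
def IsPart (P : Finset (List (Fin d))) : Prop := ∀ x, ∃! v, v ∈ P ∧ x ∈ cylinder v

/-- The words that extend `w` by one letter. -/
def children (w : List (Fin d)) : Finset (List (Fin d)) :=
  Finset.univ.image fun a : Fin d => w ++ [a]

theorem mem_children {w v : List (Fin d)} : v ∈ children w ↔ ∃ a, w ++ [a] = v := by
  simp [children]

theorem append_singleton_mem_children (w : List (Fin d)) (a : Fin d) : w ++ [a] ∈ children w :=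
  mem_children.2 ⟨a, rfl⟩

theorem prepend_head_tail (x : ℕ → Fin d) : prepend [x 0] (fun n => x (n + 1)) = x := by
  funext n
  cases n <;> rfl

theorem mem_cylinder_iff_exists_children {w : List (Fin d)} {x : ℕ → Fin d} :
    x ∈ cylinder w ↔ ∃ a, x ∈ cylinder (w ++ [a]) := by
  constructor
  · rintro ⟨y, rfl⟩
    refine ⟨y 0, fun n => y (n + 1), ?_⟩
    rw [prepend_append, prepend_head_tail]
  · rintro ⟨a, h⟩
    exact cylinder_append_subset _ _ h

theorem disjoint_children (w : List (Fin d)) {a b : Fin d} (h : a ≠ b) :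
    Disjoint (cylinder (w ++ [a])) (cylinder (w ++ [b])) :=
  disjoint_cylinder_of_length_eq (by simp) (by simpa using h)

theorem maps_of_maps_children {g : (ℕ → Fin d) ≃ₜ (ℕ → Fin d)} {w w' : List (Fin d)}
    (h : ∀ a, Maps g (w ++ [a], 1) (w' ++ [a], 1)) : Maps g (w, 1) (w', 1) := fun x => by
  have := h (x 0) (fun n => x (n + 1))
  rwa [emb_one, emb_one, prepend_append, prepend_append, prepend_head_tail] at this

theorem IsPart.disjoint {P : Finset (List (Fin d))} (hP : IsPart P) {v w : List (Fin d)}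
    (hv : v ∈ P) (hw : w ∈ P) (h : v ≠ w) : Disjoint (cylinder v) (cylinder w) :=
  Set.disjoint_left.2 fun x hxv hxw => h ((hP x).unique ⟨hv, hxv⟩ ⟨hw, hxw⟩)

theorem IsPart.isFamily {P : Finset (List (Fin d))} (hP : IsPart P)
    (H : Subgroup (Equiv.Perm (Fin d))) : IsFamily H fun v : P => ((v.1, 1) : Frame d) :=
  ⟨fun v w h => hP.disjoint v.2 w.2 fun h' => h (Subtype.ext h'), fun _ => H.one_mem⟩

theorem IsPart.eq_of_subset [Nontrivial (Fin d)] {P : Finset (List (Fin d))} (hP : IsPart P)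
    {v w : List (Fin d)} (hv : v ∈ P) (hw : w ∈ P) (h : cylinder v ⊆ cylinder w) : v = w := by
  by_contra hne
  obtain ⟨x, hx⟩ := nonempty_cylinder v
  exact Set.disjoint_left.1 (hP.disjoint hv hw hne) hx (h hx)

theorem IsPart.nonempty [Nontrivial (Fin d)] {P : Finset (List (Fin d))} (hP : IsPart P) :
    P.Nonempty := by
  obtain ⟨v, ⟨hv, -⟩, -⟩ := hP fun _ => (exists_pair_ne (Fin d)).choose
  exact ⟨v, hv⟩

theorem IsPart.eq_singleton_nil [Nontrivial (Fin d)] {P : Finset (List (Fin d))} (hP : IsPart P)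
    (h : [] ∈ P) : P = {[]} :=
  Finset.eq_singleton_iff_unique_mem.2 ⟨h, fun v hv => hP.eq_of_subset hv h (by
    rw [cylinder_nil]; exact subset_univ _)⟩

/-- A nontrivial partition contains all one-letter extensions of some word: remove the last
letter of a longest word of the partition. -/
theorem IsPart.exists_children_subset [Nontrivial (Fin d)] {P : Finset (List (Fin d))}
    (hP : IsPart P) (h : P ≠ {[]}) : ∃ w, children w ⊆ P := by
  obtain ⟨v, hv, hmax⟩ := P.exists_max_image List.length hP.nonempty
  rcases List.eq_nil_or_concat' v with rfl | ⟨w, a, rfl⟩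
  · exact absurd (hP.eq_singleton_nil hv) h
  refine ⟨w, fun u hu => ?_⟩
  obtain ⟨b, rfl⟩ := mem_children.1 hu
  obtain ⟨_, y, rfl⟩ := nonempty_cylinder (w ++ [b])
  obtain ⟨v', ⟨hv', z, hz⟩, -⟩ := hP (prepend (w ++ [b]) y)
  rcases prepend_eq_prepend _ _ _ _ hz with ⟨p, hp, -⟩ | ⟨p, rfl, -⟩
  · rcases List.eq_nil_or_concat' p with rfl | ⟨q, c, rfl⟩
    · rw [List.append_nil] at hp
      rwa [hp]
    · rw [← List.append_assoc] at hp
      obtain ⟨rfl, -⟩ := List.append_inj' hp rfl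
      have := hP.eq_of_subset hv hv' (by rw [List.append_assoc]; exact cylinder_append_subset _ _)
      exact absurd (congrArg List.length this) (by simp)
  · have hl := hmax _ hv'
    simp only [List.length_append, List.length_cons, List.length_nil] at hl
    obtain rfl : p = [] := List.length_eq_zero_iff.1 (by omega)
    rwa [List.append_nil] at hv'

theorem IsPart.collapse [Nontrivial (Fin d)] {P : Finset (List (Fin d))} (hP : IsPart P)
    {w : List (Fin d)} (hw : children w ⊆ P) : IsPart (insert w (P \ children w)) := by
  intro x
  obtain ⟨v, ⟨hv, hx⟩, huniq⟩ := hP x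
  by_cases hvw : v ∈ children w
  · obtain ⟨a, rfl⟩ := mem_children.1 hvw
    refine ⟨w, ⟨Finset.mem_insert_self _ _, cylinder_append_subset _ _ hx⟩, ?_⟩
    rintro u ⟨hu, hxu⟩
    rcases Finset.mem_insert.1 hu with rfl | hu
    · rfl
    · rw [Finset.mem_sdiff] at hu
      exact absurd (huniq u ⟨hu.1, hxu⟩ ▸ hvw) hu.2
  · refine ⟨v, ⟨Finset.mem_insert_of_mem (Finset.mem_sdiff.2 ⟨hv, hvw⟩), hx⟩, ?_⟩
    rintro u ⟨hu, hxu⟩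
    rcases Finset.mem_insert.1 hu with rfl | hu
    · obtain ⟨a, ha⟩ := mem_cylinder_iff_exists_children.1 hxu
      have hc := append_singleton_mem_children u a
      exact absurd (huniq _ ⟨hw hc, ha⟩ ▸ hc) hvw
    · exact huniq u ⟨(Finset.mem_sdiff.1 hu).1, hxu⟩

theorem IsPart.expand {P : Finset (List (Fin d))} (hP : IsPart P) {w : List (Fin d)}
    (hw : w ∈ P) : IsPart (P.erase w ∪ children w) := by
  intro x
  obtain ⟨v, ⟨hv, hx⟩, huniq⟩ := hP x
  by_cases hvw : v = w
  · subst hvw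
    obtain ⟨a, ha⟩ := mem_cylinder_iff_exists_children.1 hx
    refine ⟨v ++ [a], ⟨Finset.mem_union_right _ (append_singleton_mem_children v a), ha⟩, ?_⟩
    rintro u ⟨hu, hxu⟩
    rcases Finset.mem_union.1 hu with hu | hu
    · rw [Finset.mem_erase] at hu
      exact absurd (huniq u ⟨hu.2, hxu⟩) hu.1
    · obtain ⟨b, rfl⟩ := mem_children.1 hu
      by_contra hne
      exact Set.disjoint_left.1 (disjoint_children v fun h => hne (by rw [h])) hxu ha
  · refine ⟨v, ⟨Finset.mem_union_left _ (Finset.mem_erase.2 ⟨hvw, hv⟩), hx⟩, ?_⟩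
    rintro u ⟨hu, hxu⟩
    rcases Finset.mem_union.1 hu with hu | hu
    · exact huniq u ⟨Finset.mem_of_mem_erase hu, hxu⟩
    · obtain ⟨b, rfl⟩ := mem_children.1 hu
      exact absurd (huniq w ⟨hw, cylinder_append_subset _ _ hxu⟩).symm hvw

theorem card_children (w : List (Fin d)) : (children w).card = d := by
  rw [children, Finset.card_image_of_injective _ fun a b h => by simpa using h]
  simp

theorem card_collapse_lt [Nontrivial (Fin d)] {P : Finset (List (Fin d))} {w : List (Fin d)}
    (hw : children w ⊆ P) : (insert w (P \ children w)).card < P.card := by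
  have h1 := Finset.card_insert_le w (P \ children w)
  have h2 := Finset.card_sdiff_add_card_eq_card hw
  have h3 : 2 ≤ d := Fin.nontrivial_iff_two_le.1 inferInstance
  rw [card_children] at h2
  omega

variable {P : Finset (List (Fin d))} {g : (ℕ → Fin d) ≃ₜ (ℕ → Fin d)}
  {u : List (Fin d) → List (Fin d)} {s : List (Fin d) → Equiv.Perm (Fin d)}

theorem IsPart.image_injOn [Nontrivial (Fin d)] (hP : IsPart P)
    (h : ∀ v ∈ P, ActsAs g v (u v) (s v)) : InjOn u P := by
  intro v hv w hw hvw
  have h1 := (actsAs_iff_maps.1 (h v hv)).image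
  have h2 := (actsAs_iff_maps.1 (h w hw)).image
  simp only [← hvw, ← h1] at h2
  exact hP.eq_of_subset hv hw (g.injective.image_injective h2).symm.subset

theorem IsPart.image (hP : IsPart P) (h : ∀ v ∈ P, ActsAs g v (u v) (s v)) :
    IsPart (P.image u) := by
  intro y
  have key : ∀ v ∈ P, (y ∈ cylinder (u v) ↔ g.symm y ∈ cylinder v) := fun v hv => by
    have h1 := (actsAs_iff_maps.1 (h v hv)).image
    simp only at h1
    rw [← h1]
    constructor
    · rintro ⟨x, hx, rfl⟩
      rwa [Homeomorph.symm_apply_apply]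
    · exact fun hx => ⟨_, hx, g.apply_symm_apply y⟩
  obtain ⟨v, ⟨hv, hx⟩, huniq⟩ := hP (g.symm y)
  refine ⟨u v, ⟨Finset.mem_image_of_mem u hv, (key v hv).2 hx⟩, ?_⟩
  rintro w ⟨hw, hyw⟩
  obtain ⟨v', hv', rfl⟩ := Finset.mem_image.1 hw
  rw [huniq v' ⟨hv', (key v' hv').1 hyw⟩]

end Partitions

/-! ### Generators modulo the alternating subgroup -/

section Generators

variable {d : ℕ} {H : Subgroup (Equiv.Perm (Fin d))} {ι : Type*}

open Classical in
/-- The map `v x ↦ v s(x)`, extended by the identity: on the cylinder of `v` the permutation `s` is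
applied to all letters after the prefix `v`. -/
noncomputable def rotFun (v : List (Fin d)) (s : Equiv.Perm (Fin d)) (x : ℕ → Fin d) :
    ℕ → Fin d := fun n => if x ∈ cylinder v ∧ v.length ≤ n then s (x n) else x n

theorem rotFun_prepend (v : List (Fin d)) (s : Equiv.Perm (Fin d)) (x : ℕ → Fin d) :
    rotFun v s (prepend v x) = prepend v (s ∘ x) := by
  funext n
  rcases lt_or_ge n v.length with hn | hn
  · rw [rotFun, if_neg (by omega), prepend_apply_of_lt v _ n hn, prepend_apply_of_lt v _ n hn]
  · rw [rotFun, if_pos ⟨prepend_mem_cylinder _ _, hn⟩]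
    obtain ⟨k, rfl⟩ := Nat.exists_eq_add_of_le hn
    rw [prepend_apply_add, prepend_apply_add, comp_apply]

theorem rotFun_of_notMem {v : List (Fin d)} (s : Equiv.Perm (Fin d)) {x : ℕ → Fin d}
    (hx : x ∉ cylinder v) : rotFun v s x = x := by
  funext n
  rw [rotFun, if_neg fun h => hx h.1]

theorem rotFun_mul (v : List (Fin d)) (s t : Equiv.Perm (Fin d)) (x : ℕ → Fin d) :
    rotFun v (s * t) x = rotFun v s (rotFun v t x) := by
  by_cases hx : x ∈ cylinder v
  · obtain ⟨y, rfl⟩ := hx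
    simp only [rotFun_prepend]
    rfl
  · simp only [rotFun_of_notMem _ hx]

theorem rotFun_one (v : List (Fin d)) (x : ℕ → Fin d) : rotFun v 1 x = x := by
  funext n
  simp [rotFun]

/-- The letterwise action of `H` on the cylinder of `v`, as a homomorphism to `V d H`. -/
noncomputable def rot (H : Subgroup (Equiv.Perm (Fin d))) (v : List (Fin d)) : H →* V d H where
  toFun s := ofEquiv
    { toFun := rotFun v s
      invFun := rotFun v (s⁻¹ : H)
      left_inv := fun x => by
        rw [← rotFun_mul, ← Subgroup.coe_mul, inv_mul_cancel, Subgroup.coe_one, rotFun_one]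
      right_inv := fun x => by
        rw [← rotFun_mul, ← Subgroup.coe_mul, mul_inv_cancel, Subgroup.coe_one, rotFun_one] }
    (fun x => by
      by_cases hx : x ∈ cylinder v
      · exact ⟨v, v, s, s.2, hx, rotFun_prepend v s⟩
      · obtain ⟨w, hxw, hw⟩ := exists_cylinder_subset (isClosed_cylinder v).isOpen_compl hx
        exact ⟨w, w, 1, H.one_mem, hxw, fun y =>
          rotFun_of_notMem _ (hw (prepend_mem_cylinder w y))⟩)
  map_one' := Subtype.ext (Homeomorph.ext (rotFun_one v))
  map_mul' s t := Subtype.ext (Homeomorph.ext (rotFun_mul v s t))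

theorem rot_prepend (v : List (Fin d)) (s : H) (x : ℕ → Fin d) :
    (rot H v s).1 (prepend v x) = prepend v (s.1 ∘ x) := rotFun_prepend v s x

theorem rot_of_notMem {v : List (Fin d)} (s : H) {x : ℕ → Fin d} (hx : x ∉ cylinder v) :
    (rot H v s).1 x = x := rotFun_of_notMem s.1 hx

theorem rot_conj {g : V d H} {v w : List (Fin d)} (hg : Maps g.1 (v, 1) (w, 1)) (s : H) :
    g * rot H v s * g⁻¹ = rot H w s := by
  rw [mul_inv_eq_iff_eq_mul]
  refine Subtype.ext (Homeomorph.ext fun x => ?_)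
  change g.1 ((rot H v s).1 x) = (rot H w s).1 (g.1 x)
  have hg' : ∀ x, g.1 (prepend v x) = prepend w x := hg
  by_cases hx : x ∈ cylinder v
  · obtain ⟨y, rfl⟩ := hx
    rw [rot_prepend, hg', hg', rot_prepend]
  · rw [rot_of_notMem _ hx, rot_of_notMem]
    have h1 := hg.image
    simp only at h1
    rw [← h1]
    rintro ⟨y, hy, hyx⟩
    exact hx (g.1.injective hyx ▸ hy)

theorem isFamily_children {F : ι → Frame d} (hF : IsFamily H F) :
    IsFamily H fun p : ι × Fin d => (F p.1).child [p.2] := by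
  refine ⟨?_, fun p => hF.mem p.1⟩
  rintro ⟨i, a⟩ ⟨j, b⟩ hij
  by_cases h : i = j
  · subst h
    refine disjoint_children (F i).1 fun hab => hij ?_
    exact congrArg (Prod.mk i) ((F i).2.injective hab)
  · exact (hF.disj h).mono (cylinder_child_subset _ _) (cylinder_child_subset _ _)

/-- Permuting framed cylinders amounts to permuting their subcylinders in parallel. -/
theorem permHom_eq_permHom_children [Finite ι] {F : ι → Frame d} (hF : IsFamily H F)
    (σ : Equiv.Perm ι) :
    permHom hF σ = permHom (isFamily_children hF) (σ.prodCongr (Equiv.refl _)) := by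
  refine Subtype.ext (Homeomorph.ext fun x => ?_)
  by_cases hx : x ∈ ⋃ i, cylinder (F i).1
  · obtain ⟨i, hi⟩ := mem_iUnion.1 hx
    obtain ⟨y, rfl⟩ := mem_cylinder_iff_emb.1 hi
    rw [permHom_maps hF σ i y]
    have := permHom_maps (isFamily_children hF) (σ.prodCongr (Equiv.refl _)) (i, y 0)
      (fun n => y (n + 1))
    simp only [emb_child, prepend_head_tail, Equiv.prodCongr_apply, Prod.map_apply,
      Equiv.refl_apply] at this
    exact this.symm
  · rw [permHom_apply_of_notMem hF _ hx, permHom_apply_of_notMem]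
    intro h
    obtain ⟨p, hp⟩ := mem_iUnion.1 h
    exact hx (mem_iUnion.2 ⟨p.1, cylinder_child_subset _ _ hp⟩)

theorem permHom_swap_eq [Finite ι] [DecidableEq ι] {F : ι → Frame d} (hF : IsFamily H F)
    {i j : ι} (hinj : Injective ![i, j]) :
    permHom hF (Equiv.swap i j) = permHom (hF.comp hinj) (Equiv.swap 0 1) := by
  refine Subtype.ext (Homeomorph.ext fun x => ?_)
  by_cases hx : x ∈ ⋃ k, cylinder (F k).1
  · obtain ⟨k, hk⟩ := mem_iUnion.1 hx
    obtain ⟨y, rfl⟩ := mem_cylinder_iff_emb.1 hk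
    rw [permHom_maps hF _ k y]
    by_cases hki : k = i
    · subst hki
      have := permHom_maps (hF.comp hinj) (Equiv.swap 0 1) 0 y
      simpa using this.symm
    by_cases hkj : k = j
    · subst hkj
      have := permHom_maps (hF.comp hinj) (Equiv.swap 0 1) 1 y
      simpa using this.symm
    rw [Equiv.swap_apply_of_ne_of_ne hki hkj, permHom_apply_of_notMem]
    refine hF.notMem (k := k) ?_ hk
    rintro ⟨a, ha⟩
    fin_cases a
    · exact hki ha.symm
    · exact hkj ha.symm
  · rw [permHom_apply_of_notMem hF _ hx, permHom_apply_of_notMem]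
    intro h
    obtain ⟨p, hp⟩ := mem_iUnion.1 h
    exact hx (mem_iUnion.2 ⟨_, hp⟩)

variable {M : Subgroup (V d H)}

/-- The letter permutations of a finite family of framed cylinders can be undone by rotations. -/
theorem exists_untwist (hM : ∀ v : List (Fin d), cylinder v ≠ univ → ∀ s, rot H v s ∈ M)
    [Finite ι] {F : ι → Frame d} (hF : IsFamily H F) (hn : ∀ i, cylinder (F i).1 ≠ univ) :
    ∃ k ∈ M, (∀ i, Maps k.1 (F i) ((F i).1, 1)) ∧ ∀ x ∉ ⋃ i, cylinder (F i).1, k.1 x = x := by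
  classical
  have := Fintype.ofFinite ι
  suffices h : ∀ t : Finset ι, ∃ k ∈ M, (∀ i ∈ t, Maps k.1 (F i) ((F i).1, 1)) ∧
      ∀ x ∉ ⋃ i ∈ t, cylinder (F i).1, k.1 x = x by
    obtain ⟨k, hk, h1, h2⟩ := h Finset.univ
    exact ⟨k, hk, fun i => h1 i (Finset.mem_univ i), fun x hx => h2 x (by simpa using hx)⟩
  intro t
  induction t using Finset.induction_on with
  | empty => exact ⟨1, M.one_mem, by simp, fun _ _ => rfl⟩
  | insert i t hi ih =>
    obtain ⟨k, hk, h1, h2⟩ := ih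
    refine ⟨rot H (F i).1 ⟨(F i).2, hF.mem i⟩⁻¹ * k, M.mul_mem (hM _ (hn i) _) hk, ?_, ?_⟩
    · intro j hj
      rcases Finset.mem_insert.1 hj with rfl | hj
      · refine Maps.comp (G := F j) ?_ (maps_of_forall_mem fun x hx => h2 x ?_)
        · intro x
          rw [emb, rot_prepend]
          change prepend (F j).1 (⇑(F j).2⁻¹ ∘ ((F j).2 ∘ x)) = _
          rw [perm_inv_comp_comp, emb_one]
        · simp only [mem_iUnion, not_exists]
          intro l hl hxl
          exact Set.disjoint_left.1 (hF.disj fun h : j = l => hi (h ▸ hl)) hx hxl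
      · refine Maps.comp (maps_of_forall_mem fun x hx => rot_of_notMem _ fun hxi => ?_) (h1 j hj)
        exact Set.disjoint_left.1 (hF.disj fun h : j = i => hi (h ▸ hj)) hx hxi
    · intro x hx
      simp only [Finset.mem_insert, iUnion_iUnion_eq_or_left, mem_union, not_or] at hx
      change (rot H (F i).1 _).1 (k.1 x) = x
      rw [h2 x hx.2, rot_of_notMem _ hx.1]

variable [Nontrivial (Fin d)]

theorem conj_mem_of_altV_le (hM : altV H ≤ M) {m : V d H} (hm : m ∈ M) (g : V d H) :
    g * m * g⁻¹ ∈ M := by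
  have := M.mul_mem (hM (commutator_mem_altV g m)) hm
  rwa [commutatorElement_def, inv_mul_cancel_right] at this

/-- A subgroup that contains the alternating subgroup and one exchange of two framed cylinders
contains all permutations of framed cylinders. -/
theorem permHom_mem_of_swap_mem (hM : altV H ≤ M) {F₀ : Fin 2 → Frame d} (hF₀ : IsFamily H F₀)
    (hn₀ : (⋃ i, cylinder (F₀ i).1) ≠ univ) (hmem : permHom hF₀ (Equiv.swap 0 1) ∈ M)
    [Finite ι] {F : ι → Frame d} (hF : IsFamily H F) (σ : Equiv.Perm ι) : permHom hF σ ∈ M := by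
  classical
  rcases subsingleton_or_nontrivial ι with h | h
  · rw [Subsingleton.elim σ 1, map_one]
    exact M.one_mem
  rw [permHom_eq_permHom_children]
  generalize Equiv.prodCongr σ (Equiv.refl (Fin d)) = τ
  induction τ using Equiv.Perm.swap_induction_on with
  | one => rw [map_one]; exact M.one_mem
  | swap_mul τ p q hpq ih =>
    rw [map_mul]
    refine M.mul_mem ?_ ih
    have hinj : Injective ![p, q] := by
      intro a b
      fin_cases a <;> fin_cases b <;> simp [hpq, hpq.symm]
    -- among the at least four subcylinders there is one that the exchange does not move
    obtain ⟨r, hr⟩ : ∃ r, r ∉ range ![p, q] := by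
      by_contra! hr
      obtain ⟨i, hi⟩ := exists_ne p.1
      obtain ⟨a, ha⟩ := exists_ne p.2
      have key : ∀ r : ι × Fin d, r ≠ p → r = q := fun r hrp => by
        obtain ⟨k, hk⟩ := hr r
        fin_cases k
        · exact absurd hk.symm hrp
        · exact hk.symm
      have h1 := key (i, p.2) fun h => hi (congrArg Prod.fst h)
      have h2 := key (p.1, a) fun h => ha (congrArg Prod.snd h)
      exact hi (congrArg Prod.fst (h1.trans h2.symm))
    have hF' := isFamily_children hF
    rw [permHom_swap_eq hF' hinj]
    obtain ⟨e, -, hme⟩ := exists_altV_maps hF₀ (hF'.comp hinj) hn₀ (hF'.iUnion_ne_univ hr)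
    rw [← permHom_conj hF₀ (hF'.comp hinj) hme]
    exact conj_mem_of_altV_le hM hmem e

theorem rot_mem_of_rot_mem (hM : altV H ≤ M) {v₀ : List (Fin d)} (hv₀ : cylinder v₀ ≠ univ)
    (hmem : ∀ s, rot H v₀ s ∈ M) {v : List (Fin d)} (hv : cylinder v ≠ univ) (s : H) :
    rot H v s ∈ M := by
  have hfam : ∀ v : List (Fin d), IsFamily H fun _ : Unit => ((v, 1) : Frame d) := fun v =>
    ⟨fun _ _ h => absurd rfl h, fun _ => H.one_mem⟩
  obtain ⟨e, -, he⟩ := exists_altV_maps (hfam v₀) (hfam v) (by rwa [iUnion_const])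
    (by rwa [iUnion_const])
  rw [← rot_conj (he ())]
  exact conj_mem_of_altV_le hM (hmem s) e

theorem cylinder_append_singleton_ne_univ (w : List (Fin d)) (a : Fin d) :
    cylinder (w ++ [a]) ≠ univ := by
  obtain ⟨b, hb⟩ := exists_ne a
  obtain ⟨x, hx⟩ := nonempty_cylinder (w ++ [b])
  exact fun h => Set.disjoint_left.1 (disjoint_children w hb) hx (h ▸ mem_univ x)

theorem cylinder_eq_univ_iff {v : List (Fin d)} : cylinder v = univ ↔ v = [] := by
  constructor
  · intro h
    rcases List.eq_nil_or_concat' v with rfl | ⟨w, a, rfl⟩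
    · rfl
    · exact absurd h (cylinder_append_singleton_ne_univ w a)
  · rintro rfl
    exact cylinder_nil

/-- The permutations and the rotations of framed cylinders generate `V d H`. An element that
acts as a similarity on the pieces of a partition is multiplied by generators until it maps the
children of some word to the children of another one without permuting letters; these children
can then be merged, which makes the partition smaller. -/
theorem mem_of_generators
    (hperm : ∀ (P : Finset (List (Fin d))) (F : P → Frame d) (hF : IsFamily H F)
      (σ : Equiv.Perm P), permHom hF σ ∈ M)
    (hperm' : ∀ (F : Fin d → Frame d) (hF : IsFamily H F) (σ : Equiv.Perm (Fin d)),
      permHom hF σ ∈ M)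
    (hrot : ∀ v : List (Fin d), cylinder v ≠ univ → ∀ s, rot H v s ∈ M)
    (n : ℕ) : ∀ (P : Finset (List (Fin d))), P.card = n → IsPart P → ∀ g : V d H,
      (∀ v ∈ P, ∃ u, ∃ s ∈ H, ActsAs g.1 v u s) → g ∈ M := by
  induction n using Nat.strong_induction_on with
  | _ n ih =>
  intro P hcard hP g hg
  choose! u s hs ha using hg
  by_cases hP1 : P = {[]}
  · have hnil : [] ∈ P := hP1 ▸ Finset.mem_singleton_self _
    have ha0 := ha [] hnil
    have hu : u [] = [] := by
      rw [← cylinder_eq_univ_iff]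
      have h1 := (actsAs_iff_maps.1 ha0).image
      simp only [cylinder_nil, image_univ] at h1
      rw [← h1]
      exact g.1.surjective.range_eq
    rw [hu] at ha0
    let G : Fin d → Frame d := fun a => ([s [] a], s [])
    have hG : IsFamily H G := ⟨fun a b hab => disjoint_children [] fun h =>
      hab ((s []).injective h), fun _ => hs [] hnil⟩
    have hgG : ∀ a, Maps g.1 ([a], 1) (G a) := fun a => ha0.append [a]
    have hσ := hperm' G hG (s [])⁻¹
    have hk1 : ∀ a, Maps (permHom hG (s [])⁻¹).1 (G a) ([a], s []) := fun a => by
      have := permHom_maps hG (s [])⁻¹ a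
      simpa [G] using this
    have hF : IsFamily H fun a : Fin d => (([a], s []) : Frame d) :=
      ⟨fun a b hab => disjoint_children [] hab, fun _ => hs [] hnil⟩
    obtain ⟨k, hk, hk2, -⟩ := exists_untwist hrot hF fun a =>
      cylinder_append_singleton_ne_univ [] a
    have h1 : k * (permHom hG (s [])⁻¹ * g) = 1 := by
      refine Subtype.ext (Homeomorph.ext fun x => ?_)
      have := ((hk2 (x 0)).comp ((hk1 (x 0)).comp (hgG (x 0)))) (fun n => x (n + 1))
      rwa [emb_one, prepend_head_tail] at this
    have h2 : k * (permHom hG (s [])⁻¹ * g) ∈ M := h1 ▸ M.one_mem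
    exact (M.mul_mem_cancel_left hσ).1 ((M.mul_mem_cancel_left hk).1 h2)
  · obtain ⟨w, hw⟩ := hP.exists_children_subset hP1
    have hinj := hP.image_injOn ha
    have hQ := hP.image ha
    have hQ1 : P.image u ≠ {[]} := by
      intro h
      have h1 := Finset.card_image_of_injOn hinj
      have h2 := Finset.card_le_card hw
      have h3 : 2 ≤ d := Fin.nontrivial_iff_two_le.1 inferInstance
      rw [h, Finset.card_singleton] at h1
      rw [card_children] at h2
      omega
    obtain ⟨w', hw'⟩ := hQ.exists_children_subset hQ1
    have hex : ∀ a : Fin d, ∃ v ∈ P, u v = w' ++ [a] := fun a =>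
      Finset.mem_image.1 (hw' (append_singleton_mem_children w' a))
    choose q hqP hq using hex
    let F : P → Frame d := fun v => (u v, s v)
    have hgF : ∀ v : P, Maps g.1 (v.1, 1) (F v) := fun v => ha v v.2
    have hF : IsFamily H F := (hP.isFamily H).map_maps hgF fun v => hs v v.2
    let f₁ : Fin d ↪ P := ⟨fun a => ⟨w ++ [a], hw (append_singleton_mem_children w a)⟩,
      fun a b h => by simpa using h⟩
    let f₂ : Fin d ↪ P := ⟨fun a => ⟨q a, hqP a⟩, fun a b h => by
      have h' : q a = q b := congrArg Subtype.val h
      have := hq a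
      rw [h', hq b] at this
      simpa using this.symm⟩
    obtain ⟨σ, hσ⟩ := (Equiv.Perm.isMultiplyPretransitive P d).exists_smul_eq f₁ f₂
    have hσ' : ∀ a, σ (f₁ a) = f₂ a := fun a => DFunLike.congr_fun hσ a
    have hk1 := hperm P F hF σ
    obtain ⟨k, hk, hk2, hk3⟩ := exists_untwist hrot (hF.comp f₂.injective) fun a => by
      change cylinder (u (q a)) ≠ univ
      rw [hq]
      exact cylinder_append_singleton_ne_univ w' a
    have h1 : ∀ v : P, Maps (permHom hF σ * g).1 (v.1, 1) (F (σ v)) := fun v =>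
      (permHom_maps hF σ v).comp (hgF v)
    have h2 : Maps (k * (permHom hF σ * g)).1 (w, 1) (w', 1) := maps_of_maps_children fun a => by
      have h4 := h1 (f₁ a)
      rw [hσ' a] at h4
      have h3 : Maps (k * (permHom hF σ * g)).1 (w ++ [a], 1) (u (q a), 1) :=
        (hk2 a).comp h4
      rwa [hq] at h3
    have h3 : k * (permHom hF σ * g) ∈ M := by
      refine ih _ ?_ _ rfl (hP.collapse hw) _ ?_
      · rw [← hcard]
        exact card_collapse_lt hw
      · intro v hv
        rcases Finset.mem_insert.1 hv with rfl | hv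
        · exact ⟨w', 1, H.one_mem, h2⟩
        · rw [Finset.mem_sdiff] at hv
          refine ⟨_, _, hF.mem (σ ⟨v, hv.1⟩), Maps.comp (maps_of_forall_mem fun x hx => hk3 x ?_)
            (h1 ⟨v, hv.1⟩)⟩
          refine hF.notMem (f := f₂) ?_ hx
          rintro ⟨a, ha⟩
          rw [← hσ' a] at ha
          have h4 : w ++ [a] = v := congrArg Subtype.val (σ.injective ha)
          exact hv.2 (h4 ▸ append_singleton_mem_children w a)
    exact (M.mul_mem_cancel_left hk1).1 ((M.mul_mem_cancel_left hk).1 h3)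

end Generators

/-! ### Finite index of the alternating subgroup -/

section FiniteIndex

variable {d : ℕ}

/-- The words of length `n`. -/
def level (d n : ℕ) : Finset (List (Fin d)) :=
  Finset.univ.image fun f : Fin n → Fin d => List.ofFn f

theorem mem_level {n : ℕ} {v : List (Fin d)} : v ∈ level d n ↔ v.length = n := by
  constructor
  · intro h
    obtain ⟨f, -, rfl⟩ := Finset.mem_image.1 h
    simp
  · rintro rfl
    exact Finset.mem_image.2 ⟨v.get, Finset.mem_univ _, List.ofFn_get v⟩

theorem isPart_level (d n : ℕ) : IsPart (level d n) := by
  intro x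
  refine ⟨List.ofFn fun i : Fin n => x i, ⟨mem_level.2 (by simp), ?_⟩, ?_⟩
  · rw [cylinder_ofFn]
    exact PiNat.self_mem_cylinder x n
  · rintro v ⟨hv, hx⟩
    rw [mem_level] at hv
    subst hv
    rw [mem_cylinder_iff] at hx
    refine List.ext_getElem (by simp) fun k h1 h2 => ?_
    rw [List.getElem_ofFn, hx k h1]

theorem finiteIndex_altV [Nontrivial (Fin d)] (H : Subgroup (Equiv.Perm (Fin d))) :
    (altV H).FiniteIndex := by
  obtain ⟨F, hF, -, -⟩ := exists_family_subset H []
  obtain ⟨a, -, -⟩ := exists_pair_ne (Fin d)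
  have hinj : Injective ![(0 : Fin 5), 1] := by decide
  have hn := hF.iUnion_ne_univ (f := ![(0 : Fin 5), 1]) (k := 2) (by
    rintro ⟨i, hi⟩
    fin_cases i <;> simp at hi)
  let t := permHom (hF.comp hinj) (Equiv.swap 0 1)
  let X : Set (V d H) := insert t (range (rot H [a]))
  have hM : altV H ≤ altV H ⊔ Subgroup.closure X := le_sup_left
  have hX : X ⊆ (altV H ⊔ Subgroup.closure X : Subgroup (V d H)) := fun x hx =>
    (le_sup_right : _ ≤ altV H ⊔ Subgroup.closure X) (Subgroup.subset_closure hx)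
  have ht := hX (mem_insert _ _)
  have hr : ∀ s, rot H [a] s ∈ altV H ⊔ Subgroup.closure X := fun s =>
    hX (mem_insert_of_mem _ ⟨s, rfl⟩)
  have htop : altV H ⊔ Subgroup.closure X = ⊤ := by
    refine eq_top_iff.2 fun g _ => ?_
    obtain ⟨N, hN⟩ := exists_forall_actsAs g
    exact mem_of_generators
      (fun P F hF' σ => permHom_mem_of_swap_mem hM (hF.comp hinj) hn ht hF' σ)
      (fun F hF' σ => permHom_mem_of_swap_mem hM (hF.comp hinj) hn ht hF' σ)
      (fun v hv s => rot_mem_of_rot_mem hM (cylinder_append_singleton_ne_univ [] a) hr hv s)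
      _ (level d N) rfl (isPart_level d N) g fun v hv => hN v (mem_level.1 hv).ge
  let π := QuotientGroup.mk' (altV H)
  let _ : CommGroup (V d H ⧸ altV H) :=
    { (inferInstance : Group (V d H ⧸ altV H)) with
      mul_comm := fun x y => by
        obtain ⟨g, rfl⟩ := QuotientGroup.mk'_surjective (altV H) x
        obtain ⟨g', rfl⟩ := QuotientGroup.mk'_surjective (altV H) y
        rw [← commutatorElement_eq_one_iff_mul_comm, ← map_commutatorElement]
        exact (QuotientGroup.eq_one_iff _).2 (commutator_mem_altV g g') }
  have hclosure : Subgroup.closure (π '' X) = ⊤ := by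
    rw [← MonoidHom.map_closure, ← Subgroup.map_top_of_surjective π
      (QuotientGroup.mk'_surjective _), ← htop, Subgroup.map_sup, QuotientGroup.map_mk'_self,
      bot_sup_eq]
  have hfin : (π '' X).Finite := ((finite_range _).insert _).image _
  have hfg : Group.FG (V d H ⧸ altV H) := Group.fg_iff.2 ⟨_, hclosure, hfin⟩
  have htors : IsMulTorsion (V d H ⧸ altV H) := by
    rw [← CommGroup.torsion_eq_top_iff, ← top_le_iff, ← hclosure, Subgroup.closure_le]
    rintro _ ⟨x, hx, rfl⟩
    rcases mem_insert_iff.1 hx with rfl | ⟨s, rfl⟩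
    · exact π.isOfFinOrder ((permHom (hF.comp hinj)).isOfFinOrder (isOfFinOrder_of_finite _))
    · exact π.isOfFinOrder ((rot H [a]).isOfFinOrder (isOfFinOrder_of_finite _))
  have := CommGroup.finite_of_fg_isMulTorsion _ htors
  exact Subgroup.finiteIndex_of_finite_quotient

end FiniteIndex

/-! ### The parity of an element -/

section Parity

variable {d : ℕ}

theorem append_lt_append_of_disjoint [Nontrivial (Fin d)] {v w : List (Fin d)}
    (hd : Disjoint (cylinder v) (cylinder w)) (h : v < w) (p q : List (Fin d)) :
    v ++ p < w ++ q := by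
  induction v generalizing w with
  | nil =>
    rw [cylinder_nil, univ_disjoint] at hd
    exact absurd hd (nonempty_cylinder w).ne_empty
  | cons a v ih =>
    cases w with
    | nil =>
      rw [cylinder_nil, disjoint_univ] at hd
      exact absurd hd (nonempty_cylinder _).ne_empty
    | cons b w =>
      rw [List.cons_append, List.cons_append, List.cons_lt_cons_iff]
      rcases List.cons_lt_cons_iff.1 h with hab | ⟨rfl, hvw⟩
      · exact Or.inl hab
      · refine Or.inr ⟨rfl, ih ?_ hvw⟩
        rw [Set.disjoint_left] at hd ⊢
        rintro _ ⟨x, rfl⟩ ⟨y, hy⟩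
        refine hd (prepend_mem_cylinder (a :: v) x) ⟨y, ?_⟩
        have h1 := prepend_append [a] v x
        have h2 := prepend_append [a] w y
        rw [List.singleton_append] at h1 h2
        rw [h1, h2, hy]

theorem append_lt_append_iff [Nontrivial (Fin d)] {v w : List (Fin d)}
    (hd : Disjoint (cylinder v) (cylinder w)) (p q : List (Fin d)) :
    v ++ p < w ++ q ↔ v < w := by
  refine ⟨fun h => ?_, fun h => append_lt_append_of_disjoint hd h p q⟩
  by_contra hvw
  rcases (not_lt.1 hvw).eq_or_lt with rfl | hlt
  · obtain ⟨x, hx⟩ := nonempty_cylinder w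
    exact Set.disjoint_left.1 hd hx hx
  · exact lt_asymm h (append_lt_append_of_disjoint hd.symm hlt q p)

theorem ActsAs.word_unique [Nontrivial (Fin d)] {g : (ℕ → Fin d) ≃ₜ (ℕ → Fin d)}
    {v u u' : List (Fin d)} {s s' : Equiv.Perm (Fin d)} (h : ActsAs g v u s)
    (h' : ActsAs g v u' s') : u = u' := by
  -- if `u' = u ++ p`, then every word `s x` begins with `p`, so `p` is empty
  have key : ∀ {u u' : List (Fin d)} {s s' : Equiv.Perm (Fin d)}, ActsAs g v u s →
      ActsAs g v u' s' → ∀ p, u' = u ++ p → p = [] := by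
    rintro u _ s s' h h' p rfl
    rw [← cylinder_eq_univ_iff, eq_univ_iff_forall]
    intro x
    have h1 := h (⇑s⁻¹ ∘ x)
    rw [h', prepend_append, perm_comp_inv_comp] at h1
    exact ⟨_, prepend_injective u h1⟩
  have h1 := (h fun _ => (exists_pair_ne (Fin d)).choose).symm.trans (h' _)
  rcases prepend_eq_prepend _ _ _ _ h1 with ⟨p, hp, -⟩ | ⟨p, hp, -⟩
  · rw [hp, key h h' p hp, List.append_nil]
  · rw [hp, key h' h p hp, List.append_nil]

open Classical in
/-- The word `u` such that `g` maps the cylinder of `v` to that of `u` by a similarity; the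
empty word if there is none. -/
noncomputable def img (g : (ℕ → Fin d) ≃ₜ (ℕ → Fin d)) (v : List (Fin d)) : List (Fin d) :=
  if h : ∃ u s, ActsAs g v u s then h.choose else []

theorem ActsAs.img_eq [Nontrivial (Fin d)] {g : (ℕ → Fin d) ≃ₜ (ℕ → Fin d)}
    {v u : List (Fin d)} {s : Equiv.Perm (Fin d)} (h : ActsAs g v u s) : img g v = u := by
  have hex : ∃ u s, ActsAs g v u s := ⟨u, s, h⟩
  rw [img, dif_pos hex]
  exact hex.choose_spec.choose_spec.word_unique h

/-- `g` acts on the cylinder of each word of `P` as a similarity with letter permutation in `H`. -/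
def ActsOn (H : Subgroup (Equiv.Perm (Fin d))) (g : (ℕ → Fin d) ≃ₜ (ℕ → Fin d))
    (P : Finset (List (Fin d))) : Prop :=
  ∀ v ∈ P, ∃ s ∈ H, ActsAs g v (img g v) s

theorem actsOn_iff [Nontrivial (Fin d)] {H : Subgroup (Equiv.Perm (Fin d))}
    {g : (ℕ → Fin d) ≃ₜ (ℕ → Fin d)} {P : Finset (List (Fin d))} :
    ActsOn H g P ↔ ∀ v ∈ P, ∃ u, ∃ s ∈ H, ActsAs g v u s := by
  refine forall₂_congr fun v _ => ⟨fun ⟨s, hs, h⟩ => ⟨_, s, hs, h⟩, ?_⟩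
  rintro ⟨u, s, hs, h⟩
  exact ⟨s, hs, h.img_eq.symm ▸ h⟩

/-- The sign `(-1)^k`, where `k` is the number of pairs of words of `P` whose lexicographic
order is reversed by `g`. -/
noncomputable def inversionSign (g : (ℕ → Fin d) ≃ₜ (ℕ → Fin d)) (P : Finset (List (Fin d))) :
    ℤˣ := ∏ v ∈ P, ∏ w ∈ P, if v < w ∧ img g w < img g v then -1 else 1

theorem sign_eq_prod_prod_ite {n : ℕ} (σ : Equiv.Perm (Fin n)) :
    Equiv.Perm.sign σ = ∏ i, ∏ j, if i < j ∧ σ j < σ i then -1 else 1 := by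
  rw [σ.sign_eq_prod_prod_Ioi]
  refine Finset.prod_congr rfl fun i _ => ?_
  rw [← Finset.filter_lt_eq_Ioi, Finset.prod_filter]
  refine Finset.prod_congr rfl fun j _ => ?_
  by_cases hij : i < j
  · have hne : σ i ≠ σ j := fun h => hij.ne (σ.injective h)
    rcases lt_or_gt_of_ne hne with h | h
    · simp [hij, h, h.not_gt]
    · simp [hij, h, h.not_gt]
  · simp [hij]

theorem units_pow_of_odd (hd : Odd d) (x : ℤˣ) : x ^ d = x := by
  rcases Int.units_eq_one_or x with rfl | rfl
  · exact one_pow _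
  · exact hd.neg_one_pow

theorem prod_children {M : Type*} [CommMonoid M] (w : List (Fin d)) (f : List (Fin d) → M) :
    ∏ c ∈ children w, f c = ∏ a : Fin d, f (w ++ [a]) :=
  Finset.prod_image fun a _ b _ h => by simpa using h

variable {H : Subgroup (Equiv.Perm (Fin d))} {g : (ℕ → Fin d) ≃ₜ (ℕ → Fin d)}
  {P : Finset (List (Fin d))}

theorem disjoint_img {v w : List (Fin d)} {s t : Equiv.Perm (Fin d)}
    (hvw : Disjoint (cylinder v) (cylinder w)) (hv : ActsAs g v (img g v) s)
    (hw : ActsAs g w (img g w) t) : Disjoint (cylinder (img g v)) (cylinder (img g w)) := by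
  have h1 := (actsAs_iff_maps.1 hv).image
  have h2 := (actsAs_iff_maps.1 hw).image
  simp only at h1 h2
  rw [← h1, ← h2]
  exact (disjoint_image_iff g.injective).2 hvw

theorem IsPartition.isPart {m : ℕ} {v : Fin m → List (Fin d)} (hv : IsPartition v) :
    IsPart (Finset.univ.image v) := fun x => by
  obtain ⟨i, hi, huniq⟩ := hv x
  refine ⟨v i, ⟨Finset.mem_image_of_mem v (Finset.mem_univ i), hi⟩, ?_⟩
  rintro w ⟨hw, hx⟩
  obtain ⟨j, -, rfl⟩ := Finset.mem_image.1 hw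
  rw [huniq j hx]

theorem IsPart.isPartition (hP : IsPart P) {m : ℕ} (h : P.card = m) :
    IsPartition (P.orderEmbOfFin h) := fun x => by
  obtain ⟨v, ⟨hv, hx⟩, huniq⟩ := hP x
  rw [← Finset.mem_coe, ← Finset.range_orderEmbOfFin P h] at hv
  obtain ⟨i, rfl⟩ := hv
  exact ⟨i, hx, fun j hj => (P.orderEmbOfFin h).injective
    (huniq _ ⟨Finset.orderEmbOfFin_mem P h j, hj⟩)⟩

theorem IsTable.comp {m : ℕ} {v u w : Fin m → List (Fin d)}
    {h h' : Fin m → Equiv.Perm (Fin d)} {σ τ : Equiv.Perm (Fin m)}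
    {g' : (ℕ → Fin d) ≃ₜ (ℕ → Fin d)} (hT' : IsTable H g' u h' w τ)
    (hT : IsTable H g v h u σ) : IsTable H (g' * g) v (fun i => h' (σ i) * h i) w (τ * σ) where
  mem i := H.mul_mem (hT'.mem _) (hT.mem _)
  domain := hT.domain
  range := hT'.range
  domain_ordered := hT.domain_ordered
  range_ordered := hT'.range_ordered
  acts i x := by
    rw [Homeomorph.mul_apply, hT.acts i, hT'.acts (σ i)]
    rfl

variable [Nontrivial (Fin d)]

theorem ActsOn.expand (hg : ActsOn H g P) {w : List (Fin d)} (hw : w ∈ P) :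
    ActsOn H g (P.erase w ∪ children w) := by
  rw [actsOn_iff]
  intro v hv
  rcases Finset.mem_union.1 hv with hv | hv
  · obtain ⟨s, hs, h⟩ := hg v (Finset.mem_of_mem_erase hv)
    exact ⟨_, s, hs, h⟩
  · obtain ⟨a, rfl⟩ := mem_children.1 hv
    obtain ⟨s, hs, h⟩ := hg w hw
    exact ⟨_, s, hs, h.append [a]⟩

/-- Splitting one piece of a partition into its `d` children does not change the sign: inversions
with other pieces are repeated `d` times, and `d` is odd, while the inversions among the
children are those of a permutation in `H`, which is even. -/
theorem inversionSign_expand (hd : Odd d) (hH : ∀ s ∈ H, Equiv.Perm.sign s = 1) (hP : IsPart P)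
    (hg : ActsOn H g P) {w : List (Fin d)} (hw : w ∈ P) :
    inversionSign g (P.erase w ∪ children w) = inversionSign g P := by
  obtain ⟨s, hs, hgw⟩ := hg w hw
  have hchild : ∀ a, img g (w ++ [a]) = img g w ++ [s a] := fun a => (hgw.append [a]).img_eq
  set e : List (Fin d) → List (Fin d) → ℤˣ := fun v w =>
    if v < w ∧ img g w < img g v then -1 else 1 with he
  have hvw : ∀ v ∈ P.erase w, Disjoint (cylinder v) (cylinder w) ∧
      Disjoint (cylinder (img g v)) (cylinder (img g w)) := fun v hv => by
    rw [Finset.mem_erase] at hv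
    obtain ⟨t, -, hgv⟩ := hg v hv.2
    exact ⟨hP.disjoint hv.2 hw hv.1, disjoint_img (hP.disjoint hv.2 hw hv.1) hgv hgw⟩
  have h1 : ∀ v ∈ P.erase w, ∀ a, e v (w ++ [a]) = e v w := by
    intro v hv a
    obtain ⟨h1, h2⟩ := hvw v hv
    have h3 := append_lt_append_iff h1 [] [a]
    have h4 := append_lt_append_iff h2.symm [s a] []
    rw [List.append_nil] at h3 h4
    simp only [he, hchild, h3, h4]
  have h2 : ∀ v ∈ P.erase w, ∀ a, e (w ++ [a]) v = e w v := by
    intro v hv a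
    obtain ⟨h1, h2⟩ := hvw v hv
    have h3 := append_lt_append_iff h1.symm [a] []
    have h4 := append_lt_append_iff h2 [] [s a]
    rw [List.append_nil] at h3 h4
    simp only [he, hchild, h3, h4]
  have h3 : ∏ a : Fin d, ∏ b : Fin d, e (w ++ [a]) (w ++ [b]) = 1 := by
    rw [← hH s hs, sign_eq_prod_prod_ite]
    refine Finset.prod_congr rfl fun a _ => Finset.prod_congr rfl fun b _ => ?_
    have hlt : ∀ (u : List (Fin d)) (a b : Fin d), u ++ [a] < u ++ [b] ↔ a < b := by
      intro u a b
      induction u with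
      | nil => simp [List.cons_lt_cons_iff]
      | cons c u ih => simpa [List.cons_lt_cons_iff] using ih
    simp only [he, hchild, hlt]
  have h4 : e w w = 1 := by simp [he]
  have hdisj : Disjoint (P.erase w) (children w) := by
    rw [Finset.disjoint_left]
    intro v hv hvc
    obtain ⟨a, rfl⟩ := mem_children.1 hvc
    obtain ⟨x, hx⟩ := nonempty_cylinder (w ++ [a])
    exact Set.disjoint_left.1 (hvw _ hv).1 hx (cylinder_append_subset _ _ hx)
  change ∏ v ∈ P.erase w ∪ children w, ∏ v' ∈ P.erase w ∪ children w, e v v' =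
    ∏ v ∈ P, ∏ v' ∈ P, e v v'
  have hR : ∀ f : List (Fin d) → ℤˣ, ∏ v ∈ P, f v = f w * ∏ v ∈ P.erase w, f v := fun f =>
    (Finset.mul_prod_erase P f hw).symm
  have hA : ∏ a : Fin d, ∏ v ∈ P.erase w, e (w ++ [a]) v = ∏ v ∈ P.erase w, e w v := by
    rw [Finset.prod_congr rfl fun a _ => Finset.prod_congr rfl fun v hv => h2 v hv a,
      Finset.prod_const, Finset.card_univ, Fintype.card_fin, units_pow_of_odd hd]
  have hB : ∀ v ∈ P.erase w, ∏ a : Fin d, e v (w ++ [a]) = e v w := fun v hv => by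
    rw [Finset.prod_congr rfl fun a _ => h1 v hv a,
      Finset.prod_const, Finset.card_univ, Fintype.card_fin, units_pow_of_odd hd]
  simp only [hR, Finset.prod_union hdisj, prod_children, Finset.prod_mul_distrib]
  rw [hA, h3, h4, Finset.prod_congr rfl hB]
  rw [mul_one, one_mul]
  ac_rfl

/-- The sign may be computed on any sufficiently fine level: a piece that is shorter than the
level can be split. -/
theorem inversionSign_eq_level (hd : Odd d) (hH : ∀ s ∈ H, Equiv.Perm.sign s = 1) {N : ℕ}
    (hP : IsPart P) (hg : ActsOn H g P) (hN : ∀ v ∈ P, v.length ≤ N) :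
    inversionSign g P = inversionSign g (level d N) := by
  -- a weight that decreases when a word of length below `N` is replaced by its `d` children
  induction hm : ∑ v ∈ P, (d + 1) ^ (N - v.length) using Nat.strong_induction_on
    generalizing P with
  | _ m ih =>
  by_cases h : ∀ v ∈ P, v.length = N
  · congr 1
    refine Finset.Subset.antisymm (fun v hv => mem_level.2 (h v hv)) fun v hv => ?_
    obtain ⟨x, hx⟩ := nonempty_cylinder v
    obtain ⟨w, ⟨hw, hxw⟩, -⟩ := hP x
    rwa [(isPart_level d N x).unique ⟨hv, hx⟩ ⟨mem_level.2 (h w hw), hxw⟩]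
  · push Not at h
    obtain ⟨w, hw, hwN⟩ := h
    have hlt : w.length < N := lt_of_le_of_ne (hN w hw) hwN
    rw [← inversionSign_expand hd hH hP hg hw]
    refine ih _ ?_ (hP.expand hw) (hg.expand hw) ?_ rfl
    · rw [← hm, ← Finset.add_sum_erase P _ hw]
      have hpos : 0 < (d + 1) ^ (N - w.length - 1) := by positivity
      have h1 : ∑ v ∈ children w, (d + 1) ^ (N - v.length) =
          d * (d + 1) ^ (N - w.length - 1) := by
        rw [children, Finset.sum_image fun a _ b _ h => by simpa using h]
        simp [Nat.sub_sub]
      have h2 : (d + 1) ^ (N - w.length) = (d + 1) * (d + 1) ^ (N - w.length - 1) := by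
        rw [← pow_succ']
        congr 1
        omega
      have h3 := Finset.sum_union_inter (s₁ := P.erase w) (s₂ := children w)
        (f := fun v : List (Fin d) => (d + 1) ^ (N - v.length))
      rw [h1] at h3
      rw [h2, add_mul]
      omega
    · intro v hv
      rcases Finset.mem_union.1 hv with hv | hv
      · exact hN v (Finset.mem_of_mem_erase hv)
      · obtain ⟨a, rfl⟩ := mem_children.1 hv
        simpa using hlt

theorem inversionSign_eq (hd : Odd d) (hH : ∀ s ∈ H, Equiv.Perm.sign s = 1)
    {Q : Finset (List (Fin d))} (hP : IsPart P) (hgP : ActsOn H g P) (hQ : IsPart Q)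
    (hgQ : ActsOn H g Q) : inversionSign g P = inversionSign g Q := by
  rw [inversionSign_eq_level hd hH hP hgP (N := max (P.sup List.length) (Q.sup List.length))
      fun v hv => le_max_of_le_left (Finset.le_sup (f := List.length) hv),
    inversionSign_eq_level hd hH hQ hgQ
      fun v hv => le_max_of_le_right (Finset.le_sup (f := List.length) hv)]

/-! ### Ordered tables and the sign homomorphism -/

theorem IsPartition.injective {m : ℕ} {v : Fin m → List (Fin d)} (hv : IsPartition v) :
    Injective v := fun i j h => by
  obtain ⟨x, hx⟩ := nonempty_cylinder (v i)
  exact (hv x).unique hx (h ▸ hx)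

section Tables

variable {m : ℕ} {v u : Fin m → List (Fin d)} {h : Fin m → Equiv.Perm (Fin d)}
  {σ : Equiv.Perm (Fin m)}

theorem IsTable.actsOn (hT : IsTable H g v h u σ) :
    ActsOn H g (Finset.univ.image v) := by
  rw [actsOn_iff]
  intro w hw
  obtain ⟨i, -, rfl⟩ := Finset.mem_image.1 hw
  exact ⟨_, _, hT.mem i, hT.acts i⟩

theorem IsTable.inversionSign_eq (hT : IsTable H g v h u σ) :
    inversionSign g (Finset.univ.image v) = Equiv.Perm.sign σ := by
  have hv := (hT.domain_ordered.strictMono_of_injective hT.domain.injective)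
  have hu := (hT.range_ordered.strictMono_of_injective hT.range.injective)
  rw [inversionSign, sign_eq_prod_prod_ite, Finset.prod_image fun i _ j _ h => hv.injective h]
  refine Finset.prod_congr rfl fun i _ => ?_
  rw [Finset.prod_image fun i _ j _ h => hv.injective h]
  refine Finset.prod_congr rfl fun j _ => ?_
  simp only [(hT.acts _).img_eq, hv.lt_iff_lt, hu.lt_iff_lt]

theorem exists_isTable (hv : IsPartition v) (hm : Monotone v)
    (hg : ∀ i, ∃ u, ∃ s ∈ H, ActsAs g (v i) u s) : ∃ h u σ, IsTable H g v h u σ := by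
  have hP := hv.isPart
  have hgP : ActsOn H g (Finset.univ.image v) := by
    rw [actsOn_iff]
    intro w hw
    obtain ⟨i, -, rfl⟩ := Finset.mem_image.1 hw
    exact hg i
  choose! s hs ha using hgP
  have hQ := hP.image ha
  have hinj := hP.image_injOn ha
  have hcard : ((Finset.univ.image v).image (img g)).card = m := by
    rw [Finset.card_image_of_injOn hinj, Finset.card_image_of_injective _ hv.injective]
    simp
  have hmem : ∀ i, v i ∈ Finset.univ.image v := fun i =>
    Finset.mem_image_of_mem v (Finset.mem_univ i)
  have hex : ∀ i, ∃ j, ((Finset.univ.image v).image (img g)).orderEmbOfFin hcard j =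
      img g (v i) := fun i => by
    have := Finset.mem_image_of_mem (img g) (hmem i)
    rwa [← Finset.mem_coe, ← Finset.range_orderEmbOfFin _ hcard] at this
  choose f hf using hex
  have hfinj : Injective f := fun i j hij => by
    have h1 := hf i
    rw [hij, hf j] at h1
    exact hv.injective (hinj (hmem i) (hmem j) h1.symm)
  refine ⟨fun i => s (v i), _, Equiv.ofBijective f (Finite.injective_iff_bijective.1 hfinj),
    fun i => hs _ (hmem i), hv, hQ.isPartition hcard, hm, OrderEmbedding.monotone _, fun i => ?_⟩
  rw [Equiv.ofBijective_apply, hf]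
  exact ha _ (hmem i)

end Tables

theorem exists_actsOn_level (g : V d H) : ∃ N, ActsOn H g.1 (level d N) := by
  obtain ⟨N, hN⟩ := exists_forall_actsAs g
  exact ⟨N, actsOn_iff.2 fun v hv => hN v (mem_level.1 hv).ge⟩

/-- Two elements have composable ordered tables: on a sufficiently fine level the first one has
images that are long enough for the second one to act on them as a similarity. -/
theorem exists_isTable_isTable (g f : V d H) : ∃ (m : ℕ) (v u w : Fin m → List (Fin d))
    (h h' : Fin m → Equiv.Perm (Fin d)) (σ τ : Equiv.Perm (Fin m)),
    IsTable H f.1 v h u σ ∧ IsTable H g.1 u h' w τ := by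
  obtain ⟨N, hN⟩ := exists_forall_actsAs f
  obtain ⟨K, hK⟩ := exists_forall_actsAs g
  have hP := isPart_level d (N + K)
  have hlen : ∀ i, ((level d (N + K)).orderEmbOfFin rfl i).length = N + K := fun i =>
    mem_level.1 (Finset.orderEmbOfFin_mem _ rfl i)
  obtain ⟨h, u, σ, hT⟩ := exists_isTable (g := f.1) (hP.isPartition rfl)
    (OrderEmbedding.monotone _) fun i => hN _ (by rw [hlen]; omega)
  obtain ⟨h', w, τ, hT'⟩ := exists_isTable (g := g.1) hT.range hT.range_ordered fun i => hK _ (by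
    set v := (level d (N + K)).orderEmbOfFin rfl (σ.symm i) with hv
    obtain ⟨u', s, -, ha⟩ := hN (v.take N) (by rw [List.length_take, hlen]; omega)
    have ha' := ha.append (v.drop N)
    rw [List.take_append_drop] at ha'
    have hu := hT.acts (σ.symm i)
    rw [Equiv.apply_symm_apply] at hu
    rw [hu.word_unique ha', List.length_append, List.length_map, List.length_drop, hlen]
    omega)
  exact ⟨_, _, u, w, h, h', σ, τ, hT, hT'⟩

/-- The parity of an element of `V d H`, for `d` odd and `H` consisting of even permutations: the
sign of the permutation of any ordered table. -/
noncomputable def signHom (hd : Odd d) (hH : ∀ s ∈ H, Equiv.Perm.sign s = 1) : V d H →* ℤˣ :=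
  MonoidHom.mk' (fun g => inversionSign g.1 (level d (exists_actsOn_level g).choose)) fun g f => by
    obtain ⟨m, v, u, w, h, h', σ, τ, hT, hT'⟩ := exists_isTable_isTable g f
    have hTc : IsTable H (g * f).1 v (fun i => h' (σ i) * h i) w (τ * σ) := hT'.comp hT
    rw [NekrashevychRover.inversionSign_eq hd hH (isPart_level _ _)
        (exists_actsOn_level (g * f)).choose_spec hTc.domain.isPart hTc.actsOn,
      NekrashevychRover.inversionSign_eq hd hH (isPart_level _ _)
        (exists_actsOn_level g).choose_spec hT'.domain.isPart hT'.actsOn,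
      NekrashevychRover.inversionSign_eq hd hH (isPart_level _ _)
        (exists_actsOn_level f).choose_spec hT.domain.isPart hT.actsOn,
      hTc.inversionSign_eq, hT'.inversionSign_eq, hT.inversionSign_eq, Equiv.Perm.sign_mul]

theorem IsTable.signHom_eq (hd : Odd d) (hH : ∀ s ∈ H, Equiv.Perm.sign s = 1) {f : V d H} {m : ℕ}
    {v u : Fin m → List (Fin d)} {h : Fin m → Equiv.Perm (Fin d)} {σ : Equiv.Perm (Fin m)}
    (hT : IsTable H f.1 v h u σ) : signHom hd hH f = Equiv.Perm.sign σ := by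
  rw [← hT.inversionSign_eq]
  exact NekrashevychRover.inversionSign_eq hd hH (isPart_level _ _)
    (exists_actsOn_level f).choose_spec hT.domain.isPart hT.actsOn

theorem signHom_eq_one_iff (hd : Odd d) (hH : ∀ s ∈ H, Equiv.Perm.sign s = 1) (f : V d H) :
    signHom hd hH f = 1 ↔ IsEvenElement H f.1 := by
  constructor
  · intro h1
    obtain ⟨m, v, u, w, h, h', σ, τ, hT, -⟩ := exists_isTable_isTable 1 f
    exact ⟨m, v, h, u, σ, hT, (hT.signHom_eq hd hH).symm.trans h1⟩
  · rintro ⟨m, v, h, u, σ, hT, h1⟩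
    rw [hT.signHom_eq hd hH, h1]

theorem altV_le_ker_signHom (hd : Odd d) (hH : ∀ s ∈ H, Equiv.Perm.sign s = 1) :
    altV H ≤ (signHom hd hH).ker := by
  rw [← commutator_altV H, Subgroup.commutator_le]
  intro g _ f _
  rw [MonoidHom.mem_ker, map_commutatorElement, commutatorElement_eq_one_iff_mul_comm, mul_comm]

theorem exists_subgroup_coe_eq_VPrime (H : Subgroup (Equiv.Perm (Fin d))) :
    ∃ V' : Subgroup (V d H), (V' : Set (V d H)) = VPrime d H ∧ altV H ≤ V' := by
  by_cases hd : Even d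
  · exact ⟨⊤, by ext; simp [VPrime, hd], le_top⟩
  by_cases hH : ∃ s ∈ H, Equiv.Perm.sign s = -1
  · exact ⟨⊤, by ext; simp only [VPrime, hH, true_or, or_true, ofPred_true, Subgroup.coe_top],
      le_top⟩
  have hd' : Odd d := Nat.not_even_iff_odd.1 hd
  have hH' : ∀ s ∈ H, Equiv.Perm.sign s = 1 := fun s hs =>
    (Int.units_eq_one_or _).resolve_right fun h => hH ⟨s, hs, h⟩
  refine ⟨(signHom hd' hH').ker, ?_, altV_le_ker_signHom hd' hH'⟩
  ext f
  simp only [VPrime, hd, hH, false_or, mem_ofPred_eq, SetLike.mem_coe, MonoidHom.mem_ker]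
  exact signHom_eq_one_iff hd' hH' f

end Parity

end NekrashevychRover

theorem mainTheorem3 (d : ℕ) (hd : 2 ≤ d) (H : Subgroup (Equiv.Perm (Fin d))) :
    ∃ V' : Subgroup (NekrashevychRover.V d H),
      (V' : Set (NekrashevychRover.V d H)) = NekrashevychRover.VPrime d H ∧
        IsSimpleGroup (⁅V', V'⁆ : Subgroup (NekrashevychRover.V d H)) ∧
        (⁅V', V'⁆ : Subgroup (NekrashevychRover.V d H)).FiniteIndex := by
  have : Nontrivial (Fin d) := Fin.nontrivial_iff_two_le.2 hd
  obtain ⟨V', hV', hle⟩ := NekrashevychRover.exists_subgroup_coe_eq_VPrime H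
  refine ⟨V', hV', ?_⟩
  rw [NekrashevychRover.commutator_eq_altV hle]
  exact ⟨NekrashevychRover.isSimpleGroup_altV H, NekrashevychRover.finiteIndex_altV H⟩
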